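/- Let $M$ be a $(2m+1)$-dimensional Riemannian manifold with metric $g_M$, Levi-Civita connection $\nabla$ and an almost contact metric structure $(\phi,\xi,\eta)$: a $(1,1)$-tensor field $\phi$, a vector field $\xi$ and a $1$-form $\eta$ (all smooth) with $\phi^2=-I+\eta\otimes\xi$, $\phi\xi=0$, $\eta\circ\phi=0$, $\eta(\xi)=1$, $g_M(\phi X,\phi Y)=g_M(X,Y)-\eta(X)\eta(Y)$ and $\eta(X)=g_M(X,\xi)$. Assume that the structure is cosymplectic, i.e. normal ($[\phi,\phi]+2d\eta\otimes\xi=0$, where $[\phi,\phi]$ is the Nijenhuis tensor of $\phi$), with $\eta$ and the fundamental form $\Phi(X,Y)=g_M(X,\phi Y)$ closed. Let $(N,g_N)$ be a Riemannian manifold and let $F:M\to N$ be an anti-invariant Riemannian submersion, i.e. a smooth surjective map of maximal rank whose differential $F_*$ preserves the lengths of horizontal vectors (those in $(\ker F_*)^\perp$), and with $\phi(\ker F_*)\subseteq(\ker F_*)^\perp$. Suppose moreover that $\phi(\ker F_*)=(\ker F_*)^\perp$. Then $\xi$ is vertical (tangent to $\ker F_*$), and $F$ is harmonic, i.e. its tension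 field $\tau(F)=\operatorname{trace}(\nabla F_*)$ vanishes, where $(\nabla F_*)(X,Y)=\nabla^F_X F_*Y-F_*(\nabla_XY)$ with $\nabla^F$ the pullback of the Levi-Civita connection of $N$, if and only if $$\operatorname{Trace}(\phi\,\mathcal T_V)=0\quad\text{for every vertical vector } V\in\ker F_*,$$ where $\mathcal T$ is O'Neill's tensor $\mathcal T_XY=\mathcal H\nabla_{\mathcal VX}\mathcal VY+\mathcal V\nabla_{\mathcal VX}\mathcal HY$ ($\mathcal V$ and $\mathcal H$ being the orthogonal projections onto $\ker F_*$ and $(\ker F_*)^\perp$), and the trace is that of the endomorphism $\phi\,\mathcal T_V$ of the tangent space of $M$. -/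

import Mathlib

open Bundle Set FiberBundle VectorField
open scoped Manifold ContDiff

noncomputable section

namespace CosymplecticSubmersion

section Connection

/-! ### The Levi-Civita connection of a Riemannian manifold -/

variable {E : Type*} [NormedAddCommGroup E] [NormedSpace ℝ E] [FiniteDimensional ℝ E]
  {H : Type*} [TopologicalSpace H] {I : ModelWithCorners ℝ E H}
  {M : Type*} [TopologicalSpace M] [ChartedSpace H M] [IsManifold I ∞ M]
  [RiemannianBundle (fun x : M => TangentSpace I x)]
  [IsContMDiffRiemannianBundle I ∞ E (fun x : M => TangentSpace I x)]

set_option linter.unusedSectionVars false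

instance finiteDimensional_tangentSpace (p : M) : FiniteDimensional ℝ (TangentSpace I p) :=
  inferInstanceAs (FiniteDimensional ℝ E)

/-- The differential at `p` of the function `g(X, Y)`. -/
def dInner (X Y : Π p : M, TangentSpace I p) (p : M) : TangentSpace I p →L[ℝ] ℝ :=
  d% (fun q => inner ℝ (X q) (Y q)) p

/-- The right-hand side of the Koszul formula for `g(∇_X Y, Z)`:
`½ (X g(Y,Z) + Y g(X,Z) - Z g(X,Y) + g([X,Y],Z) - g([X,Z],Y) - g([Y,Z],X))` at `p`. -/
def koszul (X Y Z : Π p : M, TangentSpace I p) (p : M) : ℝ :=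
  (1 / 2) *
    (dInner Y Z p (X p) + dInner X Z p (Y p) - dInner X Y p (Z p)
      + inner ℝ (mlieBracket I X Y p) (Z p)
      - inner ℝ (mlieBracket I X Z p) (Y p)
      - inner ℝ (mlieBracket I Y Z p) (X p))

theorem mdifferentiableAt_inner {X Z : Π p : M, TangentSpace I p} {p : M}
    (hX : MDiffAt (T% X) p) (hZ : MDiffAt (T% Z) p) :
    MDiffAt (fun q => inner ℝ (X q) (Z q)) p :=
  MDifferentiableAt.inner_bundle (F := E) (E := fun x : M => TangentSpace I x) hX hZ

theorem dInner_comm (X Z : Π p : M, TangentSpace I p) (p : M) : dInner X Z p = dInner Z X p := by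
  simp_rw [dInner, real_inner_comm]

theorem dInner_smul_left {X Z : Π p : M, TangentSpace I p} {f : M → ℝ} {p : M}
    (hf : MDiffAt f p) (hX : MDiffAt (T% X) p) (hZ : MDiffAt (T% Z) p) (v : TangentSpace I p) :
    dInner (f • X) Z p v = f p * dInner X Z p v + d% f p v * inner ℝ (X p) (Z p) := by
  have h := mvfderiv_fun_mul hf (mdifferentiableAt_inner hX hZ)
  have h' : (fun q => inner ℝ ((f • X) q) (Z q)) = fun q => f q * inner ℝ (X q) (Z q) := by
    funext q
    exact real_inner_smul_left _ _ _
  rw [dInner, h', h]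
  simp [mul_comm, dInner]

theorem dInner_smul_right {X Z : Π p : M, TangentSpace I p} {f : M → ℝ} {p : M}
    (hf : MDiffAt f p) (hX : MDiffAt (T% X) p) (hZ : MDiffAt (T% Z) p) (v : TangentSpace I p) :
    dInner X (f • Z) p v = f p * dInner X Z p v + d% f p v * inner ℝ (X p) (Z p) := by
  rw [dInner_comm, dInner_smul_left hf hZ hX, dInner_comm, real_inner_comm]

theorem dInner_add_left {X X' Z : Π p : M, TangentSpace I p} {p : M}
    (hX : MDiffAt (T% X) p) (hX' : MDiffAt (T% X') p) (hZ : MDiffAt (T% Z) p)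
    (v : TangentSpace I p) :
    dInner (X + X') Z p v = dInner X Z p v + dInner X' Z p v := by
  have h := mvfderiv_fun_add (mdifferentiableAt_inner hX hZ) (mdifferentiableAt_inner hX' hZ)
  have h' : (fun q => inner ℝ ((X + X') q) (Z q))
      = fun q => inner ℝ (X q) (Z q) + inner ℝ (X' q) (Z q) := by
    funext q
    exact inner_add_left _ _ _
  rw [dInner, h', h]
  simp [dInner]

theorem dInner_add_right {X Z Z' : Π p : M, TangentSpace I p} {p : M}
    (hX : MDiffAt (T% X) p) (hZ : MDiffAt (T% Z) p) (hZ' : MDiffAt (T% Z') p)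
    (v : TangentSpace I p) :
    dInner X (Z + Z') p v = dInner X Z p v + dInner X Z' p v := by
  rw [dInner_comm, dInner_add_left hZ hZ' hX, dInner_comm Z, dInner_comm Z']

theorem koszul_tensorial_left {Y Z : Π p : M, TangentSpace I p} {p : M}
    (hY : MDiffAt (T% Y) p) (hZ : MDiffAt (T% Z) p) :
    TensorialAt I E (fun X => koszul X Y Z p) p where
  smul {f X} hf hX := by
    simp only [koszul, dInner_smul_left hf hX hZ, dInner_smul_left hf hX hY,
      mlieBracket_smul_left hf hX, Pi.smul_apply', map_smul, inner_add_left, inner_smul_left,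
      inner_smul_right, smul_eq_mul, neg_smul, inner_neg_left, conj_trivial]
    ring
  add {X X'} hX hX' := by
    simp only [koszul, dInner_add_left hX hX' hZ, dInner_add_left hX hX' hY,
      mlieBracket_add_left hX hX', inner_add_left, inner_add_right, Pi.add_apply, map_add]
    ring

theorem koszul_tensorial_right {X Y : Π p : M, TangentSpace I p} {p : M}
    (hX : MDiffAt (T% X) p) (hY : MDiffAt (T% Y) p) :
    TensorialAt I E (fun Z => koszul X Y Z p) p where
  smul {f Z} hf hZ := by
    simp only [koszul, dInner_smul_right hf hX hZ, dInner_smul_right hf hY hZ,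
      mlieBracket_smul_right hf hZ, Pi.smul_apply', map_smul, inner_add_left, inner_smul_left,
      inner_smul_right, smul_eq_mul, conj_trivial]
    rw [real_inner_comm (X p) (Z p), real_inner_comm (Y p) (Z p)]
    ring
  add {Z Z'} hZ hZ' := by
    simp only [koszul, dInner_add_right hX hZ hZ', dInner_add_right hY hZ hZ',
      mlieBracket_add_right hZ hZ', inner_add_left, inner_add_right, Pi.add_apply, map_add]
    ring

theorem koszul_add_middle {X Y Y' Z : Π p : M, TangentSpace I p} {p : M}
    (hX : MDiffAt (T% X) p) (hY : MDiffAt (T% Y) p) (hY' : MDiffAt (T% Y') p)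
    (hZ : MDiffAt (T% Z) p) : koszul X (Y + Y') Z p = koszul X Y Z p + koszul X Y' Z p := by
  simp only [koszul, dInner_add_left hY hY' hZ, dInner_add_right hX hY hY',
    mlieBracket_add_right hY hY', mlieBracket_add_left hY hY', inner_add_left, inner_add_right,
    Pi.add_apply, map_add]
  ring

theorem koszul_smul_middle {X Y Z : Π p : M, TangentSpace I p} {f : M → ℝ} {p : M}
    (hf : MDiffAt f p) (hX : MDiffAt (T% X) p) (hY : MDiffAt (T% Y) p) (hZ : MDiffAt (T% Z) p) :
    koszul X (f • Y) Z p = f p * koszul X Y Z p + d% f p (X p) * inner ℝ (Y p) (Z p) := by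
  simp only [koszul, dInner_smul_left hf hY hZ, dInner_smul_right hf hX hY,
    mlieBracket_smul_right hf hY, mlieBracket_smul_left hf hY, Pi.smul_apply', map_smul,
    inner_add_left, inner_smul_left, inner_smul_right, smul_eq_mul, neg_smul, inner_neg_left,
    conj_trivial]
  rw [real_inner_comm (X p) (Y p)]
  ring

open Classical in
/-- `v ↦ ∇_v Y` at `p`: the Koszul expression represented through the metric. The value at a field
`Y` that is not differentiable at `p` is irrelevant and set to zero. -/
def leviCivitaFun (Y : Π p : M, TangentSpace I p) (p : M) :
    TangentSpace I p →L[ℝ] TangentSpace I p :=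
  if hY : MDiffAt (T% Y) p then
    (InnerProductSpace.toDual ℝ
        (TangentSpace I p)).symm.toContinuousLinearEquiv.toContinuousLinearMap ∘L
      (TensorialAt.mkHom₂ (F := E) (F' := E) (fun X Z => koszul X Y Z p) p
        (fun _ hZ => koszul_tensorial_left hY hZ) (fun _ hX => koszul_tensorial_right hX hY))
  else 0

theorem inner_leviCivitaFun {X Y Z : Π p : M, TangentSpace I p} {p : M}
    (hX : MDiffAt (T% X) p) (hY : MDiffAt (T% Y) p) (hZ : MDiffAt (T% Z) p) :
    inner ℝ (leviCivitaFun Y p (X p)) (Z p) = koszul X Y Z p := by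
  have h := TensorialAt.mkHom₂_apply (F := E) (F' := E) (Φ := fun X Z => koszul X Y Z p)
    (fun _ hZ => koszul_tensorial_left hY hZ) (fun _ hX => koszul_tensorial_right hX hY) hX hZ
  rw [← h]
  simp [leviCivitaFun, hY]

/-- Every tangent vector is the value of a vector field differentiable at its base point. -/
theorem exists_field (p : M) (v : TangentSpace I p) :
    ∃ X : Π p : M, TangentSpace I p, MDiffAt (T% X) p ∧ X p = v :=
  ⟨extend E v, mdifferentiableAt_extend .., by simp⟩

variable (I M) in
/-- The Levi-Civita connection of the Riemannian manifold `M`. -/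
def leviCivita : CovariantDerivative I E (TangentSpace I : M → Type _) where
  toFun := leviCivitaFun
  isCovariantDerivativeOnUniv :=
    { add := by
        intro Y Y' p hY hY' _
        have hs : MDiffAt (T% (Y + Y')) p := mdifferentiableAt_add_section hY hY'
        ext v
        obtain ⟨X, hX, rfl⟩ := exists_field p v
        refine ext_inner_right ℝ fun w => ?_
        obtain ⟨Z, hZ, rfl⟩ := exists_field p w
        rw [inner_leviCivitaFun hX hs hZ, koszul_add_middle hX hY hY' hZ,
          ← inner_leviCivitaFun hX hY hZ, ← inner_leviCivitaFun hX hY' hZ, ← inner_add_left]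
        rfl
      leibniz := by
        intro Y f p hY hf _
        have hs : MDiffAt (T% (f • Y)) p := hf.smul_section hY
        ext v
        obtain ⟨X, hX, rfl⟩ := exists_field p v
        refine ext_inner_right ℝ fun w => ?_
        obtain ⟨Z, hZ, rfl⟩ := exists_field p w
        rw [inner_leviCivitaFun hX hs hZ, koszul_smul_middle hf hX hY hZ,
          ← inner_leviCivitaFun hX hY hZ, ← real_inner_smul_left, ← real_inner_smul_left,
          ← inner_add_left]
        rfl }

/-- The Koszul formula. -/
theorem inner_leviCivita {X Y Z : Π p : M, TangentSpace I p} {p : M}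
    (hX : MDiffAt (T% X) p) (hY : MDiffAt (T% Y) p) (hZ : MDiffAt (T% Z) p) :
    inner ℝ (leviCivita I M Y p (X p)) (Z p) = koszul X Y Z p :=
  inner_leviCivitaFun hX hY hZ

/-- The Levi-Civita connection is torsion free. -/
theorem leviCivita_torsionFree {X Y : Π p : M, TangentSpace I p} {p : M}
    (hX : MDiffAt (T% X) p) (hY : MDiffAt (T% Y) p) :
    leviCivita I M Y p (X p) - leviCivita I M X p (Y p) = mlieBracket I X Y p := by
  refine ext_inner_right ℝ fun w => ?_
  obtain ⟨Z, hZ, rfl⟩ := exists_field p w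
  rw [inner_sub_left, inner_leviCivita hX hY hZ, inner_leviCivita hY hX hZ]
  simp only [koszul, dInner_comm Y X, mlieBracket_swap_apply (V := Y) (W := X), inner_neg_left]
  ring

/-- The Levi-Civita connection is compatible with the metric. -/
theorem leviCivita_metric {X Y Z : Π p : M, TangentSpace I p} {p : M}
    (hX : MDiffAt (T% X) p) (hY : MDiffAt (T% Y) p) (hZ : MDiffAt (T% Z) p) :
    dInner Y Z p (X p) =
      inner ℝ (leviCivita I M Y p (X p)) (Z p) + inner ℝ (Y p) (leviCivita I M Z p (X p)) := by
  rw [real_inner_comm _ (Y p), inner_leviCivita hX hY hZ, inner_leviCivita hX hZ hY]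
  simp only [koszul, dInner_comm Z Y, mlieBracket_swap_apply (V := Z) (W := Y), inner_neg_left]
  ring

end Connection

section Cosymplectic

/-! ### Cosymplectic manifolds -/

variable {E : Type*} [NormedAddCommGroup E] [NormedSpace ℝ E]
  {H : Type*} [TopologicalSpace H] (I : ModelWithCorners ℝ E H)
  (M : Type*) [TopologicalSpace M] [ChartedSpace H M] [IsManifold I ∞ M]
  [RiemannianBundle (fun x : M => TangentSpace I x)]

/-- An almost contact metric structure `(φ, ξ, η)` on the Riemannian manifold `M`. -/
structure AlmostContactMetricStructure where
  /-- the `(1,1)`-tensor field -/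
  φ : Π p : M, TangentSpace I p →L[ℝ] TangentSpace I p
  /-- the characteristic vector field -/
  ξ : Π p : M, TangentSpace I p
  /-- the contact `1`-form -/
  η : Π p : M, TangentSpace I p →L[ℝ] ℝ
  smooth_φ : ContMDiff I (I.prod 𝓘(ℝ, E →L[ℝ] E)) ∞
    (fun p => (TotalSpace.mk' (E →L[ℝ] E) p (φ p) :
      TotalSpace (E →L[ℝ] E) (fun p : M => TangentSpace I p →L[ℝ] TangentSpace I p)))
  smooth_ξ : ContMDiff I I.tangent ∞ (fun p => (⟨p, ξ p⟩ : TangentBundle I M))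
  smooth_η : ContMDiff I (I.prod 𝓘(ℝ, E →L[ℝ] ℝ)) ∞
    (fun p => (TotalSpace.mk' (E →L[ℝ] ℝ) p (η p) :
      TotalSpace (E →L[ℝ] ℝ) (fun p : M => TangentSpace I p →L[ℝ] Bundle.Trivial M ℝ p)))
  φ_φ : ∀ (p : M) (v : TangentSpace I p), φ p (φ p v) = -v + η p v • ξ p
  φ_ξ : ∀ p : M, φ p (ξ p) = 0
  η_φ : ∀ (p : M) (v : TangentSpace I p), η p (φ p v) = 0
  η_ξ : ∀ p : M, η p (ξ p) = 1
  inner_φ_φ : ∀ (p : M) (v w : TangentSpace I p),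
    inner ℝ (φ p v) (φ p w) = inner ℝ v w - η p v * η p w
  η_eq_inner : ∀ (p : M) (v : TangentSpace I p), η p v = inner ℝ v (ξ p)

variable {I M}

namespace AlmostContactMetricStructure

variable (S : AlmostContactMetricStructure I M)

/-- The fundamental two-form `Φ(X, Y) = g(X, φ Y)`, on vector fields. -/
def Phi (X Y : Π p : M, TangentSpace I p) (p : M) : ℝ := inner ℝ (X p) (S.φ p (Y p))

/-- The exterior derivative of `η`: `2 dη(X,Y) = X η(Y) - Y η(X) - η([X,Y])`. -/
def dEta (X Y : Π p : M, TangentSpace I p) (p : M) : ℝ :=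
  (1 / 2) * (d% (fun q => S.η q (Y q)) p (X p) - d% (fun q => S.η q (X q)) p (Y p)
    - S.η p (mlieBracket I X Y p))

/-- The exterior derivative of `Φ`: `3 dΦ(X,Y,Z)` is
`X Φ(Y,Z) + Y Φ(Z,X) + Z Φ(X,Y) - Φ([X,Y],Z) - Φ([Y,Z],X) - Φ([Z,X],Y)`. -/
def dPhi (X Y Z : Π p : M, TangentSpace I p) (p : M) : ℝ :=
  (1 / 3) * (d% (S.Phi Y Z) p (X p) + d% (S.Phi Z X) p (Y p) + d% (S.Phi X Y) p (Z p)
    - S.Phi (mlieBracket I X Y) Z p - S.Phi (mlieBracket I Y Z) X p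
    - S.Phi (mlieBracket I Z X) Y p)

/-- The Nijenhuis tensor
`[φ,φ](X,Y) = φ² [X,Y] + [φ X, φ Y] - φ [φ X, Y] - φ [X, φ Y]`. -/
def nijenhuis (X Y : Π p : M, TangentSpace I p) (p : M) : TangentSpace I p :=
  S.φ p (S.φ p (mlieBracket I X Y p))
    + mlieBracket I (fun q => S.φ q (X q)) (fun q => S.φ q (Y q)) p
    - S.φ p (mlieBracket I (fun q => S.φ q (X q)) Y p)
    - S.φ p (mlieBracket I X (fun q => S.φ q (Y q)) p)

/-- Normality: `[φ,φ] + 2 dη ⊗ ξ = 0`. -/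
def IsNormal : Prop :=
  ∀ (p : M) (X Y : Π p : M, TangentSpace I p), MDiffAt (T% X) p → MDiffAt (T% Y) p →
    S.nijenhuis X Y p + (2 * S.dEta X Y p) • S.ξ p = 0

/-- A cosymplectic structure: normal, with `Φ` and `η` closed. -/
structure IsCosymplectic : Prop where
  normal : S.IsNormal
  closed_Phi : ∀ (p : M) (X Y Z : Π p : M, TangentSpace I p),
    MDiffAt (T% X) p → MDiffAt (T% Y) p → MDiffAt (T% Z) p → S.dPhi X Y Z p = 0
  closed_eta : ∀ (p : M) (X Y : Π p : M, TangentSpace I p),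
    MDiffAt (T% X) p → MDiffAt (T% Y) p → S.dEta X Y p = 0

end AlmostContactMetricStructure

end Cosymplectic

section Submersion

/-! ### Riemannian submersions, O'Neill's tensor `T`, harmonic maps -/

variable {E : Type*} [NormedAddCommGroup E] [NormedSpace ℝ E] [FiniteDimensional ℝ E]
  {H : Type*} [TopologicalSpace H] (I : ModelWithCorners ℝ E H)
  {M : Type*} [TopologicalSpace M] [ChartedSpace H M] [IsManifold I ∞ M]
  [RiemannianBundle (fun x : M => TangentSpace I x)]
  {E' : Type*} [NormedAddCommGroup E'] [NormedSpace ℝ E'] [FiniteDimensional ℝ E']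
  {H' : Type*} [TopologicalSpace H'] (I' : ModelWithCorners ℝ E' H')
  {N : Type*} [TopologicalSpace N] [ChartedSpace H' N] [IsManifold I' ∞ N]
  [RiemannianBundle (fun x : N => TangentSpace I' x)]

/-- The vertical space `ker F_*` at `p`. -/
def vertical (F : M → N) (p : M) : Submodule ℝ (TangentSpace I p) :=
  LinearMap.ker (mfderiv I I' F p).toLinearMap

/-- The horizontal space `(ker F_*)^⊥` at `p`. -/
def horizontal (F : M → N) (p : M) : Submodule ℝ (TangentSpace I p) := (vertical I I' F p)ᗮ

/-- A Riemannian submersion: smooth, onto, of maximal rank, and `F_*` preserves the lengths of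
horizontal vectors. -/
structure IsRiemannianSubmersion (F : M → N) : Prop where
  smooth : ContMDiff I I' ∞ F
  surjective : Function.Surjective F
  maximal_rank : ∀ p, Function.Surjective (mfderiv I I' F p)
  norm_horizontal : ∀ p, ∀ v ∈ horizontal I I' F p, ‖mfderiv I I' F p v‖ = ‖v‖

/-- An anti-invariant Riemannian submersion: `φ (ker F_*) ⊆ (ker F_*)^⊥`. -/
structure IsAntiInvariantSubmersion (S : AlmostContactMetricStructure I M) (F : M → N) : Prop
    extends IsRiemannianSubmersion I I' F where
  anti_invariant : ∀ p, (vertical I I' F p).map (S.φ p).toLinearMap ≤ horizontal I I' F p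

/-- The vertical part `𝒱 Y` of a vector field. -/
def verticalPart (F : M → N) (Y : Π p : M, TangentSpace I p) (p : M) : TangentSpace I p :=
  (vertical I I' F p).starProjection (Y p)

/-- The horizontal part `ℋ Y` of a vector field. -/
def horizontalPart (F : M → N) (Y : Π p : M, TangentSpace I p) (p : M) : TangentSpace I p :=
  (horizontal I I' F p).starProjection (Y p)

variable [IsContMDiffRiemannianBundle I ∞ E (fun x : M => TangentSpace I x)]
  [IsContMDiffRiemannianBundle I' ∞ E' (fun x : N => TangentSpace I' x)]

/-- O'Neill's tensor `T_v Y = ℋ ∇_{𝒱 v} (𝒱 Y) + 𝒱 ∇_{𝒱 v} (ℋ Y)` at `p`, for a tangent vector `v`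
at `p` and a vector field `Y`. -/
def oneillT (F : M → N) {p : M} (v : TangentSpace I p) (Y : Π p : M, TangentSpace I p) :
    TangentSpace I p :=
  (horizontal I I' F p).starProjection
      (leviCivita I M (verticalPart I I' F Y) p ((vertical I I' F p).starProjection v))
    + (vertical I I' F p).starProjection
      (leviCivita I M (horizontalPart I I' F Y) p ((vertical I I' F p).starProjection v))

/-- The trace of the endomorphism `φ T_v` of the tangent space at `p`, computed in an orthonormal
basis `(e_i)`, each `e_i` being extended to a vector field. -/
def traceφT (S : AlmostContactMetricStructure I M) (F : M → N) {p : M} (v : TangentSpace I p) : ℝ :=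
  ∑ i, inner ℝ
    (S.φ p (oneillT I I' F v (extend E (stdOrthonormalBasis ℝ (TangentSpace I p) i))))
    (stdOrthonormalBasis ℝ (TangentSpace I p) i)

/-- The pullback along `F` of the Levi-Civita connection of `N`, applied to a section `s` of
`F^{-1} TN` in the direction `v` at `p`. In the local frame `(E_a)` of `TN` given by the
trivialization at `F p`, with `s = ∑ s^a E_a ∘ F`, it is
`∑ ds^a(v) E_a + ∑ s^a(p) ∇_{F_* v} E_a`; note `extend E' (s p) = ∑ s^a(p) E_a` near `F p`. -/
def pullbackNabla (F : M → N) (s : Π p : M, TangentSpace I' (F p)) (p : M)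
    (v : TangentSpace I p) : TangentSpace I' (F p) :=
  let t := trivializationAt E' (TangentSpace I' : N → Type _) (F p)
  t.symm (F p) (d% (fun q => (t ⟨F q, s q⟩).2) p v)
    + leviCivita I' N (extend E' (s p)) (F p) (mfderiv I I' F p v)

/-- The second fundamental form `(∇F_*)(X, Y) = ∇^F_X (F_* Y) - F_* (∇_X Y)`. -/
def secondFundamentalForm (F : M → N) (X Y : Π p : M, TangentSpace I p) (p : M) :
    TangentSpace I' (F p) :=
  pullbackNabla I I' F (fun q => mfderiv I I' F q (Y q)) p (X p)
    - mfderiv I I' F p (leviCivita I M Y p (X p))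

/-- The tension field `∑ (∇F_*)(e_i, e_i)`, `(e_i)` an orthonormal basis of the tangent space at
`p`, each `e_i` being extended to a vector field. -/
def tensionField (F : M → N) (p : M) : TangentSpace I' (F p) :=
  ∑ i, secondFundamentalForm I I' F
    (extend E (stdOrthonormalBasis ℝ (TangentSpace I p) i))
    (extend E (stdOrthonormalBasis ℝ (TangentSpace I p) i)) p

/-- `F` is harmonic: its tension field vanishes. -/
def IsHarmonic (F : M → N) : Prop := ∀ p, tensionField I I' F p = 0

end Submersion

end CosymplecticSubmersion

end

noncomputable section

namespace CosymplecticSubmersion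

section Parallel

/-! ### The structure tensor of a cosymplectic manifold is parallel -/

variable {E : Type*} [NormedAddCommGroup E] [NormedSpace ℝ E] [FiniteDimensional ℝ E]
  {H : Type*} [TopologicalSpace H] {I : ModelWithCorners ℝ E H}
  {M : Type*} [TopologicalSpace M] [ChartedSpace H M] [IsManifold I ∞ M]
  [RiemannianBundle (fun x : M => TangentSpace I x)]

set_option linter.unusedSectionVars false

namespace AlmostContactMetricStructure

variable (S : AlmostContactMetricStructure I M)

/-- The vector field `φ X`. -/
def applyφ (X : Π p : M, TangentSpace I p) (p : M) : TangentSpace I p := S.φ p (X p)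

theorem mdifferentiableAt_applyφ {X : Π p : M, TangentSpace I p} {p : M}
    (hX : MDiffAt (T% X) p) : MDiffAt (T% (S.applyφ X)) p :=
  MDifferentiableAt.clm_bundle_apply (F₁ := E) (F₂ := E)
    (S.smooth_φ.mdifferentiableAt (by simp)) hX

theorem mdifferentiableAt_ξ (p : M) : MDiffAt (T% S.ξ) p :=
  S.smooth_ξ.mdifferentiableAt (by simp)

theorem inner_φ_left (p : M) (v w : TangentSpace I p) :
    inner ℝ (S.φ p v) w = -inner ℝ v (S.φ p w) := by
  have h := S.inner_φ_φ p v (S.φ p w)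
  rw [S.φ_φ, S.η_φ, inner_add_right, inner_neg_right, inner_smul_right, ← S.η_eq_inner,
    S.η_φ] at h
  linarith

variable [IsContMDiffRiemannianBundle I ∞ E (fun x : M => TangentSpace I x)]

/-- `v ↦ (∇_v φ) Y`. -/
def nablaφ (Y : Π p : M, TangentSpace I p) (p : M) (v : TangentSpace I p) : TangentSpace I p :=
  leviCivita I M (S.applyφ Y) p v - S.φ p (leviCivita I M Y p v)

/-- `(v, w) ↦ (∇_v η) w`. -/
def nablaη (p : M) (v w : TangentSpace I p) : ℝ := inner ℝ (leviCivita I M S.ξ p v) w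

theorem mvfderiv_η {X Y : Π p : M, TangentSpace I p} {p : M}
    (hX : MDiffAt (T% X) p) (hY : MDiffAt (T% Y) p) :
    d% (fun q => S.η q (Y q)) p (X p)
      = S.η p (leviCivita I M Y p (X p)) + S.nablaη p (X p) (Y p) := by
  have h := leviCivita_metric hX hY (S.mdifferentiableAt_ξ p)
  simp only [S.η_eq_inner]
  rw [nablaη, real_inner_comm (Y p)]
  exact h

theorem mdifferentiableAt_η {Y : Π p : M, TangentSpace I p} {p : M}
    (hY : MDiffAt (T% Y) p) : MDiffAt (fun q => S.η q (Y q)) p := by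
  simp only [S.η_eq_inner]
  exact mdifferentiableAt_inner hY (S.mdifferentiableAt_ξ p)

theorem mvfderiv_Phi {X Y Z : Π p : M, TangentSpace I p} {p : M}
    (hX : MDiffAt (T% X) p) (hY : MDiffAt (T% Y) p) (hZ : MDiffAt (T% Z) p) :
    d% (S.Phi Y Z) p (X p)
      = inner ℝ (leviCivita I M Y p (X p)) (S.φ p (Z p))
        + inner ℝ (Y p) (S.φ p (leviCivita I M Z p (X p)))
        + inner ℝ (Y p) (S.nablaφ Z p (X p)) := by
  have h := leviCivita_metric hX hY (S.mdifferentiableAt_applyφ hZ)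
  rw [nablaφ, inner_sub_right]
  refine Eq.trans h ?_
  simp only [applyφ]
  ring

theorem inner_nablaφ_skew {X Y Z : Π p : M, TangentSpace I p} {p : M}
    (hX : MDiffAt (T% X) p) (hY : MDiffAt (T% Y) p) (hZ : MDiffAt (T% Z) p) :
    inner ℝ (Y p) (S.nablaφ Z p (X p)) = -inner ℝ (Z p) (S.nablaφ Y p (X p)) := by
  have h : S.Phi Y Z = -S.Phi Z Y := by
    funext q
    simp only [Phi, Pi.neg_apply]
    rw [← real_inner_comm, S.inner_φ_left]
  have h1 := S.mvfderiv_Phi hX hY hZ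
  have h2 := S.mvfderiv_Phi hX hZ hY
  rw [h, mvfderiv_neg] at h1
  have e1 := S.inner_φ_left p (leviCivita I M Y p (X p)) (Z p)
  have e2 := S.inner_φ_left p (leviCivita I M Z p (X p)) (Y p)
  have e3 := real_inner_comm (S.φ p (leviCivita I M Z p (X p))) (Y p)
  have e4 := real_inner_comm (S.φ p (leviCivita I M Y p (X p))) (Z p)
  simp only [neg_apply] at h1
  linarith

theorem nablaη_symm (hη : ∀ (p : M) (X Y : Π p : M, TangentSpace I p),
      MDiffAt (T% X) p → MDiffAt (T% Y) p → S.dEta X Y p = 0) (p : M) (v w : TangentSpace I p) :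
    S.nablaη p v w = S.nablaη p w v := by
  obtain ⟨X, hX, rfl⟩ := exists_field p v
  obtain ⟨Y, hY, rfl⟩ := exists_field p w
  have h := hη p X Y hX hY
  rw [dEta, S.mvfderiv_η hX hY, S.mvfderiv_η hY hX, ← leviCivita_torsionFree hX hY, map_sub] at h
  linarith

theorem cyclic_inner_nablaφ (hΦ : ∀ (p : M) (X Y Z : Π p : M, TangentSpace I p),
      MDiffAt (T% X) p → MDiffAt (T% Y) p → MDiffAt (T% Z) p → S.dPhi X Y Z p = 0)
    {X Y Z : Π p : M, TangentSpace I p} {p : M}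
    (hX : MDiffAt (T% X) p) (hY : MDiffAt (T% Y) p) (hZ : MDiffAt (T% Z) p) :
    inner ℝ (Y p) (S.nablaφ Z p (X p)) + inner ℝ (Z p) (S.nablaφ X p (Y p))
      + inner ℝ (X p) (S.nablaφ Y p (Z p)) = 0 := by
  have h := hΦ p X Y Z hX hY hZ
  have e (U V W : Π p : M, TangentSpace I p) :
      inner ℝ (U p) (S.φ p (leviCivita I M V p (W p)))
        = -inner ℝ (leviCivita I M V p (W p)) (S.φ p (U p)) := by
    rw [real_inner_comm, S.inner_φ_left]
  rw [dPhi, S.mvfderiv_Phi hX hY hZ, S.mvfderiv_Phi hY hZ hX, S.mvfderiv_Phi hZ hX hY, Phi, Phi,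
    Phi, ← leviCivita_torsionFree hX hY, ← leviCivita_torsionFree hY hZ,
    ← leviCivita_torsionFree hZ hX] at h
  simp only [inner_sub_left, e] at h
  linarith

theorem nablaφ_applyφ {X Y : Π p : M, TangentSpace I p} {p : M}
    (hX : MDiffAt (T% X) p) (hY : MDiffAt (T% Y) p) :
    S.nablaφ (S.applyφ Y) p (X p) + S.φ p (S.nablaφ Y p (X p))
      = S.nablaη p (X p) (Y p) • S.ξ p + S.η p (Y p) • leviCivita I M S.ξ p (X p) := by
  have h : S.applyφ (S.applyφ Y) = (fun _ : M => (-1 : ℝ)) • Y + (fun q => S.η q (Y q)) • S.ξ := by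
    funext q
    simp [applyφ, S.φ_φ]
  have hη := S.mdifferentiableAt_η hY
  have h1 : MDiffAt (fun _ : M => (-1 : ℝ)) p := mdifferentiableAt_const
  have hd : d% (fun _ : M => (-1 : ℝ)) p = 0 := mvfderiv_const (-1 : ℝ)
  have hξ := S.mdifferentiableAt_ξ p
  have hc := (leviCivita I M).isCovariantDerivativeOn (s := Set.univ)
  simp only [nablaφ, map_sub]
  rw [h, hc.add (h1.smul_section hY) (hη.smul_section hξ), hc.leibniz hY h1, hc.leibniz hξ hη, hd]
  simp only [add_apply, S.φ_φ, S.mvfderiv_η hX hY,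
    ContinuousLinearMap.smulRight_apply, smul_apply, zero_apply, zero_smul, add_smul]
  module

theorem inner_nablaφ_ξ {X Y : Π p : M, TangentSpace I p} {p : M}
    (hX : MDiffAt (T% X) p) (hY : MDiffAt (T% Y) p) :
    inner ℝ (S.ξ p) (S.nablaφ Y p (X p)) = -S.nablaη p (X p) (S.φ p (Y p)) := by
  rw [S.inner_nablaφ_skew hX (S.mdifferentiableAt_ξ p) hY, nablaφ, nablaη]
  have h : S.applyφ S.ξ = 0 := by
    funext q
    exact S.φ_ξ q
  rw [h, CovariantDerivative.zero, Pi.zero_apply, zero_apply, zero_sub,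
    inner_neg_right, real_inner_comm, S.inner_φ_left]
  ring

theorem nijenhuis_eq_nablaφ {X Y : Π p : M, TangentSpace I p} {p : M}
    (hX : MDiffAt (T% X) p) (hY : MDiffAt (T% Y) p) :
    S.nijenhuis X Y p = S.nablaφ Y p (S.φ p (X p)) - S.nablaφ X p (S.φ p (Y p))
      + S.φ p (S.nablaφ X p (Y p)) - S.φ p (S.nablaφ Y p (X p)) := by
  have hφX := S.mdifferentiableAt_applyφ hX
  have hφY := S.mdifferentiableAt_applyφ hY
  have h1 := leviCivita_torsionFree hφX hφY
  have h2 := leviCivita_torsionFree hφX hY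
  have h3 := leviCivita_torsionFree hX hφY
  change _ = mlieBracket I (fun q => S.φ q (X q)) (fun q => S.φ q (Y q)) p at h1
  change _ = mlieBracket I (fun q => S.φ q (X q)) Y p at h2
  change _ = mlieBracket I X (fun q => S.φ q (Y q)) p at h3
  rw [nijenhuis, ← leviCivita_torsionFree hX hY, ← h1, ← h2, ← h3]
  simp only [nablaφ, map_sub, applyφ]
  abel

/-- On a cosymplectic manifold, `∇ φ = 0`. -/
theorem IsCosymplectic.nablaφ_eq_zero {S : AlmostContactMetricStructure I M}
    (hS : S.IsCosymplectic) {Y : Π p : M, TangentSpace I p} {p : M} (hY : MDiffAt (T% Y) p)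
    (v : TangentSpace I p) : S.nablaφ Y p v = 0 := by
  obtain ⟨X, hX, rfl⟩ := exists_field p v
  refine ext_inner_left ℝ fun w => ?_
  obtain ⟨Z, hZ, rfl⟩ := exists_field p w
  rw [inner_zero_right]
  have hφX := S.mdifferentiableAt_applyφ hX
  have hφY := S.mdifferentiableAt_applyφ hY
  have hφZ := S.mdifferentiableAt_applyφ hZ
  have pair {U V W : Π p : M, TangentSpace I p} (hU : MDiffAt (T% U) p)
      (hV : MDiffAt (T% V) p) (hW : MDiffAt (T% W) p) :
      inner ℝ (W p) (S.nablaφ (S.applyφ V) p (U p))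
        - inner ℝ (S.φ p (W p)) (S.nablaφ V p (U p))
        = S.nablaη p (U p) (V p) * S.η p (W p) + S.η p (V p) * S.nablaη p (U p) (W p) := by
    have h := congrArg (inner ℝ (W p)) (S.nablaφ_applyφ hU hV)
    rw [inner_add_right, inner_add_right, inner_smul_right, inner_smul_right, ← S.η_eq_inner,
      real_inner_comm (leviCivita I M S.ξ p (U p)) (W p)] at h
    rw [S.inner_φ_left]
    simp only [nablaη] at h ⊢
    linarith
  have symm := S.nablaη_symm hS.closed_eta p
  have swap {U V : Π p : M, TangentSpace I p} (hU : MDiffAt (T% U) p) (hV : MDiffAt (T% V) p) :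
      inner ℝ (S.φ p (X p)) (S.φ p (S.nablaφ V p (U p)))
        = inner ℝ (X p) (S.nablaφ V p (U p)) + S.η p (X p) * S.nablaη p (U p) (S.φ p (V p)) := by
    rw [S.inner_φ_φ, S.η_eq_inner p (S.nablaφ V p (U p)), real_inner_comm (S.ξ p),
      S.inner_nablaφ_ξ hU hV]
    ring
  have hN : S.nijenhuis Y Z p = 0 := by
    have h := hS.normal p Y Z hY hZ
    rwa [hS.closed_eta p Y Z hY hZ, mul_zero, zero_smul, add_zero] at h
  have hN' := congrArg (inner ℝ (S.φ p (X p))) hN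
  rw [S.nijenhuis_eq_nablaφ hY hZ, inner_sub_right, inner_add_right, inner_sub_right,
    swap hZ hY, swap hY hZ, inner_zero_right] at hN'
  have c1 := S.cyclic_inner_nablaφ hS.closed_Phi hX hY hZ
  have c2 := S.cyclic_inner_nablaφ hS.closed_Phi hX hφY hφZ
  have s1 := S.inner_nablaφ_skew hφY hX hφZ
  have s2 := S.inner_nablaφ_skew hY hX hZ
  have s4 := S.inner_nablaφ_skew hX hφY hφZ
  have s3 := S.inner_nablaφ_skew hX hY hZ
  have p1 := pair hφY hZ hX
  have p2 := pair hφZ hY hX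
  have p3 := pair hX hY hφZ
  simp only [applyφ, S.φ_φ, S.η_φ, inner_add_left, inner_neg_left, real_inner_smul_left,
    S.inner_nablaφ_ξ hX hY] at c2 s1 s4 p1 p2 p3
  rw [symm (S.φ p (Y p)) (Z p), symm (S.φ p (Y p)) (X p)] at p1
  rw [symm (S.φ p (Z p)) (Y p), symm (S.φ p (Z p)) (X p)] at p2
  linarith

end AlmostContactMetricStructure

end Parallel

section Calculus

/-! ### Vector-valued functions on manifolds -/

variable {E : Type*} [NormedAddCommGroup E] [NormedSpace ℝ E]
  {H : Type*} [TopologicalSpace H] {I : ModelWithCorners ℝ E H}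
  {M : Type*} [TopologicalSpace M] [ChartedSpace H M]
  {E' : Type*} [NormedAddCommGroup E'] [NormedSpace ℝ E']
  {H' : Type*} [TopologicalSpace H'] {I' : ModelWithCorners ℝ E' H'}
  {N : Type*} [TopologicalSpace N] [ChartedSpace H' N]
  {V W : Type*} [NormedAddCommGroup V] [NormedSpace ℝ V] [NormedAddCommGroup W] [NormedSpace ℝ W]

theorem mvfderiv_clm_apply {c : M → V →L[ℝ] W} {u : M → V} {p : M}
    (hc : MDiffAt c p) (hu : MDiffAt u p) (v : TangentSpace I p) :
    d% (fun q => c q (u q)) p v = (d% c p v) (u p) + c p (d% u p v) := by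
  have h := (isBoundedBilinearMap_apply (𝕜 := ℝ) (E := V) (F := W)).hasFDerivAt (c p, u p)
  have hcu : HasMFDerivAt I 𝓘(ℝ, (V →L[ℝ] W) × V) (fun q => (c q, u q)) p
      ((d% c p).prod (d% u p)) :=
    ⟨hc.continuousAt.prodMk hu.continuousAt, hc.hasMFDerivAt.2.prodMk hu.hasMFDerivAt.2⟩
  have h' := HasMFDerivAt.comp (g := fun x : (V →L[ℝ] W) × V => x.1 x.2) p h.hasMFDerivAt hcu
  have h'' := h'.mfderiv
  have := congrArg (fun A : TangentSpace I p →L[ℝ] W => A v) h''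
  refine Eq.trans this ?_
  exact add_comm _ _

theorem mvfderiv_comp_vector {g : N → V} {F : M → N} {p : M} (hg : MDiffAt g (F p))
    (hF : MDiffAt F p) (v : TangentSpace I p) :
    d% (fun q => g (F q)) p v = d% g (F p) (mfderiv I I' F p v) :=
  congrArg (fun A : TangentSpace I p →L[ℝ] V => A v) (mfderiv_comp p hg hF)

theorem mvfderiv_eq_fderiv (f : V → W) (x : V) :
    (d% f x : V →L[ℝ] W) = fderiv ℝ f x := by
  rw [mvfderiv, mfderiv_eq_fderiv]
  rfl

theorem mvfderiv_congr {f g : M → V} {p : M} (h : f =ᶠ[nhds p] g) : d% f p = d% g p := by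
  have h' := h.mfderiv_eq (I := I) (I' := 𝓘(ℝ, V))
  exact h'

end Calculus

section Gram

/-! ### The metric in a trivialization -/

variable {E : Type*} [NormedAddCommGroup E] [NormedSpace ℝ E] [FiniteDimensional ℝ E]
  {H : Type*} [TopologicalSpace H] {I : ModelWithCorners ℝ E H}
  {M : Type*} [TopologicalSpace M] [ChartedSpace H M] [IsManifold I ∞ M]

set_option linter.unusedSectionVars false

theorem extend_eventuallyEq_symmL (p : M) (v : TangentSpace I p) :
    ∀ᶠ q in nhds p, extend E v q
      = (trivializationAt E (TangentSpace I : M → Type _) p).symmL ℝ q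
          (trivializationAt E (TangentSpace I : M → Type _) p ⟨p, v⟩).2 := by
  set t := trivializationAt E (TangentSpace I : M → Type _) p
  filter_upwards [t.open_baseSet.mem_nhds (mem_baseSet_trivializationAt' p)] with q hq
  rw [t.symmL_apply hq]
  rfl

variable [RiemannianBundle (fun x : M => TangentSpace I x)]
  [IsContMDiffRiemannianBundle I ∞ E (fun x : M => TangentSpace I x)]

variable (I) in
/-- The metric at `q`, read in the trivialization of the tangent bundle at `p`. -/
def gram (p q : M) : E →L[ℝ] E →L[ℝ] ℝ :=
  (innerSL ℝ (E := TangentSpace I q)).bilinearComp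
    ((trivializationAt E (TangentSpace I : M → Type _) p).symmL ℝ q)
    ((trivializationAt E (TangentSpace I : M → Type _) p).symmL ℝ q)

theorem gram_apply (p q : M) (a b : E) :
    gram I p q a b = inner ℝ
      ((trivializationAt E (TangentSpace I : M → Type _) p).symmL ℝ q a)
      ((trivializationAt E (TangentSpace I : M → Type _) p).symmL ℝ q b) :=
  rfl

theorem mdifferentiableAt_gram (p : M) : MDiffAt (gram I p) p := by
  obtain ⟨g, hg, hgi⟩ := IsContMDiffRiemannianBundle.exists_contMDiff (IB := I) (n := ∞) (F := E)
    (E := fun x : M => TangentSpace I x)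
  have h := ((mdifferentiableAt_hom_bundle _).1 (hg.mdifferentiableAt (x := p) (by simp))).2
  refine h.congr_of_eventuallyEq ?_
  set t := trivializationAt E (TangentSpace I : M → Type _) p with ht
  filter_upwards [t.open_baseSet.mem_nhds (mem_baseSet_trivializationAt' p)] with q hq
  ext a b
  rw [gram_apply, hgi]
  rw [ContinuousLinearMap.inCoordinates]
  simp only [ContinuousLinearMap.comp_apply]
  rw [Trivialization.continuousLinearMapAt_apply_of_mem, hom_trivializationAt_apply]
  · simp [ContinuousLinearMap.inCoordinates, ← ht]
  · exact ⟨hq, mem_univ _⟩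

/-- A vector field is differentiable at a point if its inner products with differentiable vector
fields are. -/
theorem mdifferentiableAt_of_inner {X : Π p : M, TangentSpace I p} {p : M}
    (h : ∀ v : TangentSpace I p, MDiffAt (fun q => inner ℝ (X q) (extend E v q)) p) :
    MDiffAt (T% X) p := by
  set t := trivializationAt E (TangentSpace I : M → Type _) p with ht
  have hp : p ∈ t.baseSet := mem_baseSet_trivializationAt' p
  have hinv (q : M) (hq : q ∈ t.baseSet) : (gram I p q).IsInvertible := by
    have hinj : Function.Injective (gram I p q).toLinearMap := by
      refine (injective_iff_map_eq_zero _).2 fun a ha => ?_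
      have h0 : inner ℝ (t.symmL ℝ q a) (t.symmL ℝ q a) = (0 : ℝ) := by
        rw [← gram_apply]
        exact congrArg (fun l : E →L[ℝ] ℝ => l a) ha
      rw [inner_self_eq_zero] at h0
      have := congrArg (t.continuousLinearMapAt ℝ q) h0
      rwa [t.continuousLinearMapAt_symmL hq, map_zero] at this
    have hdim : Module.finrank ℝ E = Module.finrank ℝ (E →L[ℝ] ℝ) := by
      rw [← Subspace.dual_finrank_eq (K := ℝ) (V := E)]
      exact LinearMap.toContinuousLinearMap.finrank_eq
    exact ⟨(LinearEquiv.ofInjectiveOfFinrankEq _ hinj hdim).toContinuousLinearEquiv, by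
      ext; rfl⟩
  let b := Module.finBasis ℝ E
  let ℓ : M → E →L[ℝ] ℝ := fun q => ∑ i,
    inner ℝ (X q) (t.symmL ℝ q (b i)) • (b.coord i).toContinuousLinearMap
  have hℓ : MDiffAt ℓ p := by
    have hsum : ℓ = ∑ i, fun q =>
        (inner ℝ (X q) (t.symmL ℝ q (b i)) : ℝ) • (b.coord i).toContinuousLinearMap := by
      funext q
      simp [ℓ]
    rw [hsum]
    refine MDifferentiableAt.sum (I := I) fun i _ => ?_
    refine MDifferentiableAt.smul (f := fun q => inner ℝ (X q) (t.symmL ℝ q (b i))) ?_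
      mdifferentiableAt_const
    refine (h (t.symmL ℝ p (b i))).congr_of_eventuallyEq ?_
    filter_upwards [extend_eventuallyEq_symmL p (t.symmL ℝ p (b i))] with q hq
    have hb : (t ⟨p, t.symmL ℝ p (b i)⟩).2 = b i := by
      rw [← t.continuousLinearMapAt_apply_of_mem (R := ℝ) hp, t.continuousLinearMapAt_symmL hp]
    rw [hq]
    exact congrArg (fun a => inner ℝ (X q) (t.symmL ℝ q a)) hb.symm
  rw [mdifferentiableAt_section]
  have hdiff : MDiffAt (fun q => (gram I p q).inverse (ℓ q)) p := by
    refine MDifferentiableAt.clm_apply ?_ hℓ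
    exact (((hinv p hp).contDiffAt_map_inverse (n := 1)).differentiableAt
      one_ne_zero).comp_mdifferentiableAt (mdifferentiableAt_gram p)
  refine hdiff.congr_of_eventuallyEq ?_
  filter_upwards [t.open_baseSet.mem_nhds hp] with q hq
  have key : gram I p q (t ⟨q, X q⟩).2 = ℓ q := by
    refine ContinuousLinearMap.coe_injective (b.ext fun i => ?_)
    have hX : t.symmL ℝ q (t ⟨q, X q⟩).2 = X q := by
      rw [← t.continuousLinearMapAt_apply_of_mem (R := ℝ) hq, t.symmL_continuousLinearMapAt hq]
    simp only [ContinuousLinearMap.coe_coe, gram_apply, ← ht, hX, ℓ]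
    rw [sum_apply, Finset.sum_eq_single i] <;>
      simp +contextual
  obtain ⟨e, he⟩ := hinv q hq
  rw [← key, ← he, ContinuousLinearMap.inverse_equiv]
  exact (e.symm_apply_apply _).symm

end Gram

section Projections

/-! ### The horizontal and vertical projections of a Riemannian submersion -/

variable {E : Type*} [NormedAddCommGroup E] [NormedSpace ℝ E] [FiniteDimensional ℝ E]
  {H : Type*} [TopologicalSpace H] {I : ModelWithCorners ℝ E H}
  {M : Type*} [TopologicalSpace M] [ChartedSpace H M] [IsManifold I ∞ M]
  [RiemannianBundle (fun x : M => TangentSpace I x)]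
  {E' : Type*} [NormedAddCommGroup E'] [NormedSpace ℝ E'] [FiniteDimensional ℝ E']
  {H' : Type*} [TopologicalSpace H'] {I' : ModelWithCorners ℝ E' H'}
  {N : Type*} [TopologicalSpace N] [ChartedSpace H' N] [IsManifold I' ∞ N]
  [RiemannianBundle (fun x : N => TangentSpace I' x)]

set_option linter.unusedSectionVars false

theorem mem_vertical {F : M → N} {p : M} {v : TangentSpace I p} :
    v ∈ vertical I I' F p ↔ mfderiv I I' F p v = 0 :=
  LinearMap.mem_ker

theorem horizontalPart_mem (F : M → N) (Y : Π p : M, TangentSpace I p) (p : M) :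
    horizontalPart I I' F Y p ∈ horizontal I I' F p :=
  Submodule.starProjection_apply_mem _ _

theorem verticalPart_mem (F : M → N) (Y : Π p : M, TangentSpace I p) (p : M) :
    verticalPart I I' F Y p ∈ vertical I I' F p :=
  Submodule.starProjection_apply_mem _ _

theorem verticalPart_add_horizontalPart (F : M → N) (Y : Π p : M, TangentSpace I p) (p : M) :
    verticalPart I I' F Y p + horizontalPart I I' F Y p = Y p :=
  Submodule.starProjection_add_starProjection_orthogonal (K := vertical I I' F p) (Y p)

theorem mfderiv_horizontalPart (F : M → N) (Y : Π p : M, TangentSpace I p) (p : M) :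
    mfderiv I I' F p (horizontalPart I I' F Y p) = mfderiv I I' F p (Y p) := by
  conv_rhs => rw [← verticalPart_add_horizontalPart (I := I) (I' := I') F Y p, map_add,
    mem_vertical.1 (verticalPart_mem F Y p), zero_add]

theorem IsRiemannianSubmersion.inner_mfderiv_of_mem {F : M → N}
    (hF : IsRiemannianSubmersion I I' F) {p : M} {v w : TangentSpace I p}
    (hv : v ∈ horizontal I I' F p) (hw : w ∈ horizontal I I' F p) :
    inner ℝ (mfderiv I I' F p v) (mfderiv I I' F p w) = inner ℝ v w := by
  rw [real_inner_eq_norm_add_mul_self_sub_norm_mul_self_sub_norm_mul_self_div_two,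
    real_inner_eq_norm_add_mul_self_sub_norm_mul_self_sub_norm_mul_self_div_two v, ← map_add,
    hF.norm_horizontal p v hv, hF.norm_horizontal p w hw,
    hF.norm_horizontal p _ (Submodule.add_mem _ hv hw)]

/-- `F_*` preserves inner products in which one factor is horizontal. -/
theorem IsRiemannianSubmersion.inner_mfderiv {F : M → N}
    (hF : IsRiemannianSubmersion I I' F) {p : M} (v : TangentSpace I p) {w : TangentSpace I p}
    (hw : w ∈ horizontal I I' F p) :
    inner ℝ (mfderiv I I' F p v) (mfderiv I I' F p w) = inner ℝ v w := by
  have h := Submodule.starProjection_add_starProjection_orthogonal (K := vertical I I' F p) v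
  have h1 : mfderiv I I' F p ((vertical I I' F p).starProjection v) = 0 :=
    mem_vertical.1 (Submodule.starProjection_apply_mem _ _)
  have h2 : inner ℝ ((vertical I I' F p).starProjection v) w = (0 : ℝ) :=
    hw _ (Submodule.starProjection_apply_mem _ _)
  rw [← h, map_add, h1, zero_add, inner_add_left, h2, zero_add]
  exact hF.inner_mfderiv_of_mem (Submodule.starProjection_apply_mem _ _) hw

theorem mdifferentiableAt_mfderiv_apply {F : M → N} (hF : ContMDiff I I' ∞ F)
    {Y : Π p : M, TangentSpace I p} {p : M} (hY : MDiffAt (T% Y) p) :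
    MDiffAt (fun q => (⟨F q, mfderiv I I' F q (Y q)⟩ : TangentBundle I' N)) p := by
  have h : ContMDiff I.tangent I'.tangent ∞ (tangentMap I I' F) :=
    hF.contMDiff_tangentMap (by simp)
  exact (h.mdifferentiableAt (x := ⟨p, Y p⟩) (by simp)).comp p hY

variable [IsContMDiffRiemannianBundle I ∞ E (fun x : M => TangentSpace I x)]
  [IsContMDiffRiemannianBundle I' ∞ E' (fun x : N => TangentSpace I' x)]

theorem IsRiemannianSubmersion.mdifferentiableAt_horizontalPart {F : M → N}
    (hF : IsRiemannianSubmersion I I' F) {Y : Π p : M, TangentSpace I p} {p : M}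
    (hY : MDiffAt (T% Y) p) : MDiffAt (T% (horizontalPart I I' F Y)) p := by
  refine mdifferentiableAt_of_inner fun v => ?_
  have hZ : MDiffAt (T% (extend E v : Π q : M, TangentSpace I q)) p :=
    mdifferentiableAt_extend ..
  have h : (fun q => inner ℝ (horizontalPart I I' F Y q) (extend E v q))
      = fun q => (inner ℝ (mfderiv I I' F q (Y q)) (mfderiv I I' F q (extend E v q)) : ℝ) := by
    funext q
    rw [← mfderiv_horizontalPart F Y q, real_inner_comm,
      ← hF.inner_mfderiv _ (horizontalPart_mem F Y q), real_inner_comm]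
  rw [h]
  exact MDifferentiableAt.inner_bundle (F := E') (E := fun x : N => TangentSpace I' x)
    (mdifferentiableAt_mfderiv_apply hF.smooth hY) (mdifferentiableAt_mfderiv_apply hF.smooth hZ)

theorem IsRiemannianSubmersion.mdifferentiableAt_verticalPart {F : M → N}
    (hF : IsRiemannianSubmersion I I' F) {Y : Π p : M, TangentSpace I p} {p : M}
    (hY : MDiffAt (T% Y) p) : MDiffAt (T% (verticalPart I I' F Y)) p := by
  have h : verticalPart I I' F Y = Y - horizontalPart I I' F Y := by
    funext q
    rw [Pi.sub_apply, ← verticalPart_add_horizontalPart (I' := I') F Y q, add_sub_cancel_right]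
  rw [h]
  exact mdifferentiableAt_sub_section hY (hF.mdifferentiableAt_horizontalPart hY)

end Projections

section PullbackConnection

/-! ### The pullback connection -/

variable {E : Type*} [NormedAddCommGroup E] [NormedSpace ℝ E]
  {H : Type*} [TopologicalSpace H] {I : ModelWithCorners ℝ E H}
  {M : Type*} [TopologicalSpace M] [ChartedSpace H M] [IsManifold I ∞ M]
  {E' : Type*} [NormedAddCommGroup E'] [NormedSpace ℝ E'] [FiniteDimensional ℝ E']
  {H' : Type*} [TopologicalSpace H'] {I' : ModelWithCorners ℝ E' H'}
  {N : Type*} [TopologicalSpace N] [ChartedSpace H' N] [IsManifold I' ∞ N]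
  {F : M → N} {s t : Π p : M, TangentSpace I' (F p)} {p : M}

set_option linter.unusedSectionVars false

/-- The coordinates of a section along `F` in the trivialization of `TN` at `F p`. -/
def coordAlong (F : M → N) (p : M) (s : Π p : M, TangentSpace I' (F p)) (q : M) : E' :=
  (trivializationAt E' (TangentSpace I' : N → Type _) (F p) ⟨F q, s q⟩).2

theorem mdifferentiableAt_coordAlong
    (hs : MDiffAt (fun q => (⟨F q, s q⟩ : TangentBundle I' N)) p) :
    MDiffAt (coordAlong F p s) p :=
  ((mdifferentiableAt_totalSpace _ _).1 hs).2

theorem eventually_mem_baseSet (hF : MDiffAt F p) :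
    ∀ᶠ q in nhds p, F q ∈ (trivializationAt E' (TangentSpace I' : N → Type _) (F p)).baseSet :=
  hF.continuousAt ((trivializationAt E' (TangentSpace I' : N → Type _) (F p)).open_baseSet.mem_nhds
    (mem_baseSet_trivializationAt' (F p)))

theorem coordAlong_eq {q : M}
    (hq : F q ∈ (trivializationAt E' (TangentSpace I' : N → Type _) (F p)).baseSet) :
    coordAlong F p s q
      = (trivializationAt E' (TangentSpace I' : N → Type _) (F p)).continuousLinearMapAt ℝ (F q)
          (s q) :=
  (Trivialization.continuousLinearMapAt_apply_of_mem (R := ℝ) _ hq _).symm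

theorem symmL_coordAlong {q : M}
    (hq : F q ∈ (trivializationAt E' (TangentSpace I' : N → Type _) (F p)).baseSet) :
    (trivializationAt E' (TangentSpace I' : N → Type _) (F p)).symmL ℝ (F q) (coordAlong F p s q)
      = s q := by
  rw [coordAlong_eq hq, Trivialization.symmL_continuousLinearMapAt _ hq]

variable [RiemannianBundle (fun x : N => TangentSpace I' x)]
  [IsContMDiffRiemannianBundle I' ∞ E' (fun x : N => TangentSpace I' x)]

theorem pullbackNabla_eq (v : TangentSpace I p) :
    pullbackNabla I I' F s p v
      = (trivializationAt E' (TangentSpace I' : N → Type _) (F p)).symmL ℝ (F p)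
          (d% (coordAlong F p s) p v)
        + leviCivita I' N (extend E' (s p)) (F p) (mfderiv I I' F p v) := by
  rw [Trivialization.symmL_apply _ (mem_baseSet_trivializationAt' (F p))]
  rfl

theorem leviCivita_extend_add {y : N} (a b : TangentSpace I' y) :
    leviCivita I' N (extend E' (a + b)) y
      = leviCivita I' N (extend E' a) y + leviCivita I' N (extend E' b) y := by
  have ha : MDiffAt (T% (extend E' a : Π q : N, TangentSpace I' q)) y :=
    mdifferentiableAt_extend ..
  have hb : MDiffAt (T% (extend E' b : Π q : N, TangentSpace I' q)) y :=
    mdifferentiableAt_extend ..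
  have hab : MDiffAt (T% (extend E' (a + b) : Π q : N, TangentSpace I' q)) y :=
    mdifferentiableAt_extend ..
  have hc := (leviCivita I' N).isCovariantDerivativeOn (s := Set.univ)
  rw [← hc.add ha hb]
  refine hc.congr_of_eventuallyEq hab (mdifferentiableAt_add_section ha hb) Filter.univ_mem ?_
  filter_upwards [extend_eventuallyEq_symmL y a, extend_eventuallyEq_symmL y b,
    extend_eventuallyEq_symmL y (a + b)] with q h1 h2 h3
  have hy := mem_baseSet_trivializationAt' (F := E') (E := (TangentSpace I' : N → Type _)) y
  rw [Pi.add_apply, h1, h2, h3, ← map_add]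
  simp only [← Trivialization.continuousLinearMapAt_apply_of_mem (R := ℝ) _ hy, map_add]

theorem leviCivita_extend_smul {y : N} (c : ℝ) (a : TangentSpace I' y) :
    leviCivita I' N (extend E' (c • a)) y = c • leviCivita I' N (extend E' a) y := by
  have ha : MDiffAt (T% (extend E' a : Π q : N, TangentSpace I' q)) y :=
    mdifferentiableAt_extend ..
  have hca : MDiffAt (T% (extend E' (c • a) : Π q : N, TangentSpace I' q)) y :=
    mdifferentiableAt_extend ..
  have hc := (leviCivita I' N).isCovariantDerivativeOn (s := Set.univ)
  rw [← hc.smul_const c ha]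
  refine hc.congr_of_eventuallyEq hca (mdifferentiableAt_const.smul_section ha) Filter.univ_mem ?_
  filter_upwards [extend_eventuallyEq_symmL y a, extend_eventuallyEq_symmL y (c • a)] with q h1 h3
  have hy := mem_baseSet_trivializationAt' (F := E') (E := (TangentSpace I' : N → Type _)) y
  rw [Pi.smul_apply, h1, h3, ← map_smul]
  simp only [← Trivialization.continuousLinearMapAt_apply_of_mem (R := ℝ) _ hy, map_smul]

theorem pullbackNabla_add (hF : MDiffAt F p)
    (hs : MDiffAt (fun q => (⟨F q, s q⟩ : TangentBundle I' N)) p)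
    (ht : MDiffAt (fun q => (⟨F q, t q⟩ : TangentBundle I' N)) p) (v : TangentSpace I p) :
    pullbackNabla I I' F (s + t) p v
      = pullbackNabla I I' F s p v + pullbackNabla I I' F t p v := by
  have h : coordAlong F p (s + t) =ᶠ[nhds p] coordAlong F p s + coordAlong F p t := by
    filter_upwards [eventually_mem_baseSet hF] with q hq
    simp only [Pi.add_apply, coordAlong_eq hq, map_add]
  rw [pullbackNabla_eq, pullbackNabla_eq, pullbackNabla_eq, mvfderiv_congr h,
    mvfderiv_add (mdifferentiableAt_coordAlong hs) (mdifferentiableAt_coordAlong ht), Pi.add_apply,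
    leviCivita_extend_add]
  simp only [add_apply, map_add]
  abel

theorem pullbackNabla_smul (hF : MDiffAt F p) {f : M → ℝ} (hf : MDiffAt f p)
    (hs : MDiffAt (fun q => (⟨F q, s q⟩ : TangentBundle I' N)) p) (v : TangentSpace I p) :
    pullbackNabla I I' F (fun q => f q • s q) p v
      = f p • pullbackNabla I I' F s p v + d% f p v • s p := by
  have h : coordAlong F p (fun q => f q • s q) =ᶠ[nhds p] f • coordAlong F p s := by
    filter_upwards [eventually_mem_baseSet hF] with q hq
    simp only [Pi.smul_apply', coordAlong_eq hq, map_smul]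
  rw [pullbackNabla_eq, pullbackNabla_eq, mvfderiv_congr h,
    mvfderiv_smul hf (mdifferentiableAt_coordAlong hs), leviCivita_extend_smul]
  have h2 := symmL_coordAlong (s := s) (mem_baseSet_trivializationAt' (F := E')
    (E := (TangentSpace I' : N → Type _)) (F p))
  simp only [add_apply, map_add, smul_apply, ContinuousLinearMap.smulRight_apply, map_smul, h2]
  module

/-- The pullback connection is compatible with the metric. -/
theorem mvfderiv_inner_along (hF : MDiffAt F p)
    (hs : MDiffAt (fun q => (⟨F q, s q⟩ : TangentBundle I' N)) p)
    (ht : MDiffAt (fun q => (⟨F q, t q⟩ : TangentBundle I' N)) p) (v : TangentSpace I p) :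
    d% (fun q => (inner ℝ (s q) (t q) : ℝ)) p v
      = inner ℝ (pullbackNabla I I' F s p v) (t p)
        + inner ℝ (s p) (pullbackNabla I I' F t p v) := by
  set τ := trivializationAt E' (TangentSpace I' : N → Type _) (F p)
  have hp : F p ∈ τ.baseSet := mem_baseSet_trivializationAt' (F p)
  have hG := mdifferentiableAt_gram (I := I') (F p)
  have hGF : MDiffAt (fun q => gram I' (F p) (F q)) p := hG.comp p hF
  have hs' := mdifferentiableAt_coordAlong hs
  have ht' := mdifferentiableAt_coordAlong ht
  have h : (fun q => (inner ℝ (s q) (t q) : ℝ)) =ᶠ[nhds p]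
      fun q => gram I' (F p) (F q) (coordAlong F p s q) (coordAlong F p t q) := by
    filter_upwards [eventually_mem_baseSet hF] with q hq
    rw [gram_apply, symmL_coordAlong hq, symmL_coordAlong hq]
  have key (a b : TangentSpace I' (F p)) (w : TangentSpace I' (F p)) :
      d% (gram I' (F p)) (F p) w (τ ⟨F p, a⟩).2 (τ ⟨F p, b⟩).2
        = inner ℝ (leviCivita I' N (extend E' a) (F p) w) b
          + inner ℝ a (leviCivita I' N (extend E' b) (F p) w) := by
    have ha : MDiffAt (T% (extend E' a : Π q : N, TangentSpace I' q)) (F p) :=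
      mdifferentiableAt_extend ..
    have hb : MDiffAt (T% (extend E' b : Π q : N, TangentSpace I' q)) (F p) :=
      mdifferentiableAt_extend ..
    have hw : MDiffAt (T% (extend E' w : Π q : N, TangentSpace I' q)) (F p) :=
      mdifferentiableAt_extend ..
    have hm := leviCivita_metric hw ha hb
    simp only [extend_apply_self] at hm
    rw [← hm, dInner]
    have hd : (fun q => (inner ℝ (extend E' a q) (extend E' b q) : ℝ)) =ᶠ[nhds (F p)]
        fun q => gram I' (F p) q (τ ⟨F p, a⟩).2 (τ ⟨F p, b⟩).2 := by
      filter_upwards [extend_eventuallyEq_symmL (F p) a, extend_eventuallyEq_symmL (F p) b]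
        with q h1 h2
      rw [gram_apply, h1, h2]
    rw [mvfderiv_congr hd, mvfderiv_clm_apply (hG.clm_apply mdifferentiableAt_const)
      mdifferentiableAt_const, mvfderiv_clm_apply hG mdifferentiableAt_const, mvfderiv_const,
      mvfderiv_const]
    simp
  rw [mvfderiv_congr h, mvfderiv_clm_apply (hGF.clm_apply hs') ht', mvfderiv_clm_apply hGF hs',
    mvfderiv_comp_vector hG hF, add_apply, gram_apply, gram_apply, symmL_coordAlong hp,
    symmL_coordAlong hp, pullbackNabla_eq, pullbackNabla_eq, inner_add_left, inner_add_right]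
  have := key (s p) (t p) (mfderiv I I' F p v)
  rw [show (d% (gram I' (F p)) (F p) (mfderiv I I' F p v) (coordAlong F p s p)
    (coordAlong F p t p)) = _ from this]
  ring

end PullbackConnection

section Symmetry

/-! ### Symmetry of the second fundamental form -/

variable {E : Type*} [NormedAddCommGroup E] [NormedSpace ℝ E] [FiniteDimensional ℝ E]
  {M : Type*} [TopologicalSpace M] [ChartedSpace E M] [IsManifold 𝓘(ℝ, E) ∞ M]

set_option linter.unusedSectionVars false

/-- The fields `extend E v`, which are constant in a chart, commute. -/
theorem mlieBracket_extend (p : M) (v w : TangentSpace 𝓘(ℝ, E) p) :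
    mlieBracket 𝓘(ℝ, E) (extend E v) (extend E w) p = 0 := by
  have hconst (v : TangentSpace 𝓘(ℝ, E) p) :
      mpullbackWithin 𝓘(ℝ, E) 𝓘(ℝ, E) (extChartAt 𝓘(ℝ, E) p).symm (extend E v) (range 𝓘(ℝ, E))
        =ᶠ[nhds (extChartAt 𝓘(ℝ, E) p p)]
          fun _ => (trivializationAt E (TangentSpace 𝓘(ℝ, E) : M → Type _) p ⟨p, v⟩).2 := by
    have hsymm : Filter.Tendsto (extChartAt 𝓘(ℝ, E) p).symm (nhds (extChartAt 𝓘(ℝ, E) p p))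
        (nhds p) := by
      have := continuousAt_extChartAt_symm (I := 𝓘(ℝ, E)) p
      rwa [ContinuousAt, extChartAt_to_inv] at this
    filter_upwards [hsymm (extend_eventuallyEq_symmL p v),
      extChartAt_target_mem_nhds (I := 𝓘(ℝ, E)) p] with z hz hzt
    have hzs : (extChartAt 𝓘(ℝ, E) p).symm z ∈ (chartAt E p).source := by
      rw [← extChartAt_source 𝓘(ℝ, E)]
      exact (extChartAt 𝓘(ℝ, E) p).map_target hzt
    rw [mpullbackWithin_apply]
    change extend E v ((extChartAt 𝓘(ℝ, E) p).symm z) = _ at hz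
    rw [hz, TangentBundle.symmL_trivializationAt hzs, (extChartAt 𝓘(ℝ, E) p).right_inv hzt]
    have hi := isInvertible_mfderivWithin_extChartAt_symm (I := 𝓘(ℝ, E)) hzt
    exact hi.inverse_apply_self _
  have h : lieBracketWithin ℝ
      (mpullbackWithin 𝓘(ℝ, E) 𝓘(ℝ, E) (extChartAt 𝓘(ℝ, E) p).symm (extend E v) (range 𝓘(ℝ, E)))
      (mpullbackWithin 𝓘(ℝ, E) 𝓘(ℝ, E) (extChartAt 𝓘(ℝ, E) p).symm (extend E w) (range 𝓘(ℝ, E)))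
      ((extChartAt 𝓘(ℝ, E) p).symm ⁻¹' univ ∩ range 𝓘(ℝ, E)) (extChartAt 𝓘(ℝ, E) p p) = 0 := by
    refine ((hconst v).lieBracketWithin_vectorField_eq_nhds (hconst w)).trans ?_
    simp [lieBracketWithin]
  rw [← mlieBracketWithin_univ, mlieBracketWithin_apply]
  exact (congrArg _ h).trans (map_zero _)

variable [RiemannianBundle (fun x : M => TangentSpace 𝓘(ℝ, E) x)]
  [IsContMDiffRiemannianBundle 𝓘(ℝ, E) ∞ E (fun x : M => TangentSpace 𝓘(ℝ, E) x)]
  {E' : Type*} [NormedAddCommGroup E'] [NormedSpace ℝ E'] [FiniteDimensional ℝ E']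
  {N : Type*} [TopologicalSpace N] [ChartedSpace E' N] [IsManifold 𝓘(ℝ, E') ∞ N]
  [RiemannianBundle (fun x : N => TangentSpace 𝓘(ℝ, E') x)]
  [IsContMDiffRiemannianBundle 𝓘(ℝ, E') ∞ E' (fun x : N => TangentSpace 𝓘(ℝ, E') x)]

theorem leviCivita_extend_comm (p : M) (v w : TangentSpace 𝓘(ℝ, E) p) :
    leviCivita 𝓘(ℝ, E) M (extend E w) p v = leviCivita 𝓘(ℝ, E) M (extend E v) p w := by
  have hv : MDiffAt (T% (extend E v : Π q : M, TangentSpace 𝓘(ℝ, E) q)) p :=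
    mdifferentiableAt_extend ..
  have hw : MDiffAt (T% (extend E w : Π q : M, TangentSpace 𝓘(ℝ, E) q)) p :=
    mdifferentiableAt_extend ..
  have h := leviCivita_torsionFree hv hw
  rw [mlieBracket_extend, extend_apply_self, extend_apply_self, sub_eq_zero] at h
  exact h

/-- The coordinates of `F_*` applied to a field constant in a chart are given by the differential
of `F` in charts. -/
theorem coordAlong_mfderiv_extend {F : M → N} (hF : ContMDiff 𝓘(ℝ, E) 𝓘(ℝ, E') ∞ F) (p : M)
    (w : TangentSpace 𝓘(ℝ, E) p) :
    coordAlong F p (fun q => mfderiv 𝓘(ℝ, E) 𝓘(ℝ, E') F q (extend E w q)) =ᶠ[nhds p]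
      fun q => fderiv ℝ (writtenInExtChartAt 𝓘(ℝ, E) 𝓘(ℝ, E') p F) (extChartAt 𝓘(ℝ, E) p q)
        (trivializationAt E (TangentSpace 𝓘(ℝ, E) : M → Type _) p ⟨p, w⟩).2 := by
  filter_upwards [extend_eventuallyEq_symmL p w,
    eventually_mem_baseSet (I' := 𝓘(ℝ, E')) (hF.mdifferentiableAt (x := p) (by simp)),
    (chartAt E p).open_source.mem_nhds (mem_chart_source E p)] with q hq hq' hqs
  have hqe : q ∈ (extChartAt 𝓘(ℝ, E) p).source := by rwa [extChartAt_source]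
  have hqt := (extChartAt 𝓘(ℝ, E) p).map_source hqe
  have hsymm : MDifferentiableAt 𝓘(ℝ, E) 𝓘(ℝ, E) (extChartAt 𝓘(ℝ, E) p).symm
      (extChartAt 𝓘(ℝ, E) p q) := by
    have := mdifferentiableWithinAt_extChartAt_symm (I := 𝓘(ℝ, E)) hqt
    rwa [modelWithCornersSelf_coe, range_id, mdifferentiableWithinAt_univ] at this
  have hinv : (extChartAt 𝓘(ℝ, E) p).symm (extChartAt 𝓘(ℝ, E) p q) = q :=
    (extChartAt 𝓘(ℝ, E) p).left_inv hqe
  have hFq : MDifferentiableAt 𝓘(ℝ, E) 𝓘(ℝ, E') F q := hF.mdifferentiableAt (by simp)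
  have hψ : MDifferentiableAt 𝓘(ℝ, E') 𝓘(ℝ, E') (extChartAt 𝓘(ℝ, E') (F p)) (F q) :=
    mdifferentiableAt_extChartAt hq'
  rw [coordAlong_eq hq', hq, TangentBundle.continuousLinearMapAt_trivializationAt hq',
    TangentBundle.symmL_trivializationAt hqs, ← mfderiv_eq_fderiv, modelWithCornersSelf_coe,
    range_id, mfderivWithin_univ]
  have h1 : MDifferentiableAt 𝓘(ℝ, E) 𝓘(ℝ, E') (F ∘ (extChartAt 𝓘(ℝ, E) p).symm)
      (extChartAt 𝓘(ℝ, E) p q) := MDifferentiableAt.comp _ (by rwa [hinv]) hsymm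
  have e1 := mfderiv_comp_of_eq (I := 𝓘(ℝ, E)) (I' := 𝓘(ℝ, E)) (I'' := 𝓘(ℝ, E'))
    (g := F) hFq hsymm hinv
  have e2 := mfderiv_comp_of_eq (I := 𝓘(ℝ, E)) (I' := 𝓘(ℝ, E')) (I'' := 𝓘(ℝ, E'))
    (g := extChartAt 𝓘(ℝ, E') (F p)) hψ h1 (congrArg F hinv)
  have hcongr : ∀ z, z = q → ∀ u : E,
      mfderiv 𝓘(ℝ, E') 𝓘(ℝ, E') (extChartAt 𝓘(ℝ, E') (F p)) (F z) (mfderiv 𝓘(ℝ, E) 𝓘(ℝ, E') F z u)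
        = mfderiv 𝓘(ℝ, E') 𝓘(ℝ, E') (extChartAt 𝓘(ℝ, E') (F p)) (F q)
          (mfderiv 𝓘(ℝ, E) 𝓘(ℝ, E') F q u) := by
    rintro _ rfl u
    rfl
  rw [writtenInExtChartAt, e2, e1]
  exact (hcongr _ hinv _).symm

theorem mvfderiv_coordAlong_mfderiv_extend {F : M → N} (hF : ContMDiff 𝓘(ℝ, E) 𝓘(ℝ, E') ∞ F)
    (p : M) (v w : TangentSpace 𝓘(ℝ, E) p) :
    d% (coordAlong F p (fun q => mfderiv 𝓘(ℝ, E) 𝓘(ℝ, E') F q (extend E w q))) p v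
      = d% (coordAlong F p (fun q => mfderiv 𝓘(ℝ, E) 𝓘(ℝ, E') F q (extend E v q))) p w := by
  set f := writtenInExtChartAt 𝓘(ℝ, E) 𝓘(ℝ, E') p F
  set t := trivializationAt E (TangentSpace 𝓘(ℝ, E) : M → Type _) p
  have hf : ContDiffAt ℝ ∞ f (extChartAt 𝓘(ℝ, E) p p) := by
    have := (contMDiffAt_iff.1 (hF p)).2
    rwa [modelWithCornersSelf_coe, range_id, contDiffWithinAt_univ] at this
  have hf' : DifferentiableAt ℝ (fderiv ℝ f) (extChartAt 𝓘(ℝ, E) p p) :=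
    (hf.fderiv_right (m := 1) (by norm_cast)).differentiableAt one_ne_zero
  have hφ : MDifferentiableAt 𝓘(ℝ, E) 𝓘(ℝ, E) (extChartAt 𝓘(ℝ, E) p) p :=
    mdifferentiableAt_extChartAt (mem_chart_source E p)
  have key (v w : TangentSpace 𝓘(ℝ, E) p) :
      d% (coordAlong F p (fun q => mfderiv 𝓘(ℝ, E) 𝓘(ℝ, E') F q (extend E w q))) p v
        = fderiv ℝ (fderiv ℝ f) (extChartAt 𝓘(ℝ, E) p p) (t ⟨p, v⟩).2 (t ⟨p, w⟩).2 := by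
    have hd : MDifferentiableAt 𝓘(ℝ, E) 𝓘(ℝ, E →L[ℝ] E')
        (fun q => fderiv ℝ f (extChartAt 𝓘(ℝ, E) p q)) p :=
      hf'.comp_mdifferentiableAt hφ
    rw [mvfderiv_congr (coordAlong_mfderiv_extend hF p w),
      mvfderiv_clm_apply hd mdifferentiableAt_const, mvfderiv_const,
      mvfderiv_comp_vector hf'.mdifferentiableAt hφ,
      ← Trivialization.continuousLinearMapAt_apply_of_mem (R := ℝ) t
        (mem_baseSet_trivializationAt' p) v,
      TangentBundle.continuousLinearMapAt_trivializationAt (mem_chart_source E p)]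
    rw [zero_apply, map_zero, add_zero, mvfderiv_eq_fderiv]
    rfl
  rw [key, key]
  exact (hf.isSymmSndFDerivAt (by simpa using ENat.LEInfty.out)).eq _ _

theorem secondFundamentalForm_extend_comm {F : M → N} (hF : ContMDiff 𝓘(ℝ, E) 𝓘(ℝ, E') ∞ F)
    (p : M) (v w : TangentSpace 𝓘(ℝ, E) p) :
    secondFundamentalForm 𝓘(ℝ, E) 𝓘(ℝ, E') F (extend E v) (extend E w) p
      = secondFundamentalForm 𝓘(ℝ, E) 𝓘(ℝ, E') F (extend E w) (extend E v) p := by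
  simp only [secondFundamentalForm, pullbackNabla_eq, extend_apply_self]
  rw [mvfderiv_coordAlong_mfderiv_extend hF p v w, leviCivita_extend_comm (F p),
    leviCivita_extend_comm p]

end Symmetry

section HessianTensor

/-! ### The second fundamental form as a tensor -/

variable {E : Type*} [NormedAddCommGroup E] [NormedSpace ℝ E] [FiniteDimensional ℝ E]
  {M : Type*} [TopologicalSpace M] [ChartedSpace E M] [IsManifold 𝓘(ℝ, E) ∞ M]
  [RiemannianBundle (fun x : M => TangentSpace 𝓘(ℝ, E) x)]
  [IsContMDiffRiemannianBundle 𝓘(ℝ, E) ∞ E (fun x : M => TangentSpace 𝓘(ℝ, E) x)]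
  {E' : Type*} [NormedAddCommGroup E'] [NormedSpace ℝ E'] [FiniteDimensional ℝ E']
  {N : Type*} [TopologicalSpace N] [ChartedSpace E' N] [IsManifold 𝓘(ℝ, E') ∞ N]
  [RiemannianBundle (fun x : N => TangentSpace 𝓘(ℝ, E') x)]
  [IsContMDiffRiemannianBundle 𝓘(ℝ, E') ∞ E' (fun x : N => TangentSpace 𝓘(ℝ, E') x)]
  {F : M → N} {p : M}

set_option linter.unusedSectionVars false

theorem tensorialAt_secondFundamentalForm (hF : ContMDiff 𝓘(ℝ, E) 𝓘(ℝ, E') ∞ F)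
    (X : Π p : M, TangentSpace 𝓘(ℝ, E) p) :
    TensorialAt 𝓘(ℝ, E) E
      (fun Y => secondFundamentalForm 𝓘(ℝ, E) 𝓘(ℝ, E') F X Y p) p where
  smul {f Y} hf hY := by
    have hFp : MDifferentiableAt 𝓘(ℝ, E) 𝓘(ℝ, E') F p := hF.mdifferentiableAt (by simp)
    have hc := (leviCivita 𝓘(ℝ, E) M).isCovariantDerivativeOn (s := Set.univ)
    have h := pullbackNabla_smul hFp hf (mdifferentiableAt_mfderiv_apply hF hY) (X p)
    simp only [secondFundamentalForm, Pi.smul_apply', map_smul, hc.leibniz hY hf]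
    rw [h]
    simp only [add_apply, smul_apply, map_add, map_smul, ContinuousLinearMap.smulRight_apply]
    module
  add {Y Y'} hY hY' := by
    have hFp : MDifferentiableAt 𝓘(ℝ, E) 𝓘(ℝ, E') F p := hF.mdifferentiableAt (by simp)
    have hc := (leviCivita 𝓘(ℝ, E) M).isCovariantDerivativeOn (s := Set.univ)
    have h := pullbackNabla_add hFp (mdifferentiableAt_mfderiv_apply hF hY)
      (mdifferentiableAt_mfderiv_apply hF hY') (X p)
    simp only [secondFundamentalForm, Pi.add_apply, map_add, hc.add hY hY']
    refine (congrArg₂ (· - ·) h rfl).trans ?_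
    simp only [add_apply, map_add]
    abel

/-- The second fundamental form `∇F_*` at `p`, as a bilinear map. -/
def hessian (hF : ContMDiff 𝓘(ℝ, E) 𝓘(ℝ, E') ∞ F) (p : M) :
    TangentSpace 𝓘(ℝ, E) p →ₗ[ℝ] TangentSpace 𝓘(ℝ, E) p →ₗ[ℝ] TangentSpace 𝓘(ℝ, E') (F p) :=
  LinearMap.mk₂ ℝ
    (fun v w => TensorialAt.mkHom (F := E)
      (fun Y => secondFundamentalForm 𝓘(ℝ, E) 𝓘(ℝ, E') F (extend E v) Y p) p
      (tensorialAt_secondFundamentalForm hF _) w)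
    (fun v v' w => by
      simp only [TensorialAt.mkHom_apply_eq_extend, secondFundamentalForm, extend_apply_self,
        pullbackNabla_eq, map_add]
      abel)
    (fun c v w => by
      simp only [TensorialAt.mkHom_apply_eq_extend, secondFundamentalForm, extend_apply_self,
        pullbackNabla_eq, map_smul]
      module)
    (fun v w w' => map_add _ w w')
    (fun c v w => map_smul _ c w)

theorem hessian_extend (hF : ContMDiff 𝓘(ℝ, E) 𝓘(ℝ, E') ∞ F) (v w : TangentSpace 𝓘(ℝ, E) p) :
    hessian hF p v w
      = secondFundamentalForm 𝓘(ℝ, E) 𝓘(ℝ, E') F (extend E v) (extend E w) p :=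
  rfl

theorem hessian_apply (hF : ContMDiff 𝓘(ℝ, E) 𝓘(ℝ, E') ∞ F) (v : TangentSpace 𝓘(ℝ, E) p)
    {Y : Π p : M, TangentSpace 𝓘(ℝ, E) p} (hY : MDiffAt (T% Y) p) :
    hessian hF p v (Y p)
      = pullbackNabla 𝓘(ℝ, E) 𝓘(ℝ, E') F (fun q => mfderiv 𝓘(ℝ, E) 𝓘(ℝ, E') F q (Y q)) p v
        - mfderiv 𝓘(ℝ, E) 𝓘(ℝ, E') F p (leviCivita 𝓘(ℝ, E) M Y p v) := by
  have h := TensorialAt.mkHom_apply (F := E) (tensorialAt_secondFundamentalForm hF (extend E v)) hY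
  refine h.trans ?_
  rw [secondFundamentalForm, extend_apply_self]

theorem hessian_comm (hF : ContMDiff 𝓘(ℝ, E) 𝓘(ℝ, E') ∞ F) (v w : TangentSpace 𝓘(ℝ, E) p) :
    hessian hF p v w = hessian hF p w v :=
  secondFundamentalForm_extend_comm hF p v w

theorem hessian_of_vertical (hF : ContMDiff 𝓘(ℝ, E) 𝓘(ℝ, E') ∞ F) (v : TangentSpace 𝓘(ℝ, E) p)
    {W : Π p : M, TangentSpace 𝓘(ℝ, E) p} (hW : MDiffAt (T% W) p)
    (hWv : ∀ q, W q ∈ vertical 𝓘(ℝ, E) 𝓘(ℝ, E') F q) :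
    hessian hF p v (W p)
      = -mfderiv 𝓘(ℝ, E) 𝓘(ℝ, E') F p (leviCivita 𝓘(ℝ, E) M W p v) := by
  have hFp : MDifferentiableAt 𝓘(ℝ, E) 𝓘(ℝ, E') F p := hF.mdifferentiableAt (by simp)
  have hd := mdifferentiableAt_mfderiv_apply hF hW
  have h := pullbackNabla_add hFp hd hd v
  have h0 : (fun q => mfderiv 𝓘(ℝ, E) 𝓘(ℝ, E') F q (W q)) = 0 := by
    funext q
    exact mem_vertical.1 (hWv q)
  rw [h0] at h
  have h' : pullbackNabla 𝓘(ℝ, E) 𝓘(ℝ, E') F (0 : Π q : M, TangentSpace 𝓘(ℝ, E') (F q)) p v = 0 := by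
    rw [add_zero] at h
    exact left_eq_add.1 h
  rw [hessian_apply hF v hW, h0, h', zero_sub]

variable (hF : IsRiemannianSubmersion 𝓘(ℝ, E) 𝓘(ℝ, E') F)
include hF

theorem inner_hessian_horizontal_skew (u : TangentSpace 𝓘(ℝ, E) p) {v w : TangentSpace 𝓘(ℝ, E) p}
    (hv : v ∈ horizontal 𝓘(ℝ, E) 𝓘(ℝ, E') F p) (hw : w ∈ horizontal 𝓘(ℝ, E) 𝓘(ℝ, E') F p) :
    inner ℝ (hessian hF.smooth p u v) (mfderiv 𝓘(ℝ, E) 𝓘(ℝ, E') F p w)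
      = -inner ℝ (hessian hF.smooth p u w) (mfderiv 𝓘(ℝ, E) 𝓘(ℝ, E') F p v) := by
  have hFp : MDifferentiableAt 𝓘(ℝ, E) 𝓘(ℝ, E') F p := hF.smooth.mdifferentiableAt (by simp)
  have hproj {v : TangentSpace 𝓘(ℝ, E) p} (hv : v ∈ horizontal 𝓘(ℝ, E) 𝓘(ℝ, E') F p) :
      ∃ Y : Π p : M, TangentSpace 𝓘(ℝ, E) p, MDiffAt (T% Y) p ∧ Y p = v ∧
        ∀ q, Y q ∈ horizontal 𝓘(ℝ, E) 𝓘(ℝ, E') F q :=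
    ⟨horizontalPart 𝓘(ℝ, E) 𝓘(ℝ, E') F (extend E v),
      hF.mdifferentiableAt_horizontalPart (mdifferentiableAt_extend ..), by
        rw [horizontalPart, extend_apply_self]
        exact Submodule.starProjection_eq_self_iff.2 hv, fun q => horizontalPart_mem F _ q⟩
  obtain ⟨Y, hY, rfl, hYh⟩ := hproj hv
  obtain ⟨Z, hZ, rfl, hZh⟩ := hproj hw
  obtain ⟨X, hX, rfl⟩ := exists_field p u
  have h1 := mvfderiv_inner_along hFp (mdifferentiableAt_mfderiv_apply hF.smooth hY)
    (mdifferentiableAt_mfderiv_apply hF.smooth hZ) (X p)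
  have h2 : (fun q => (inner ℝ (mfderiv 𝓘(ℝ, E) 𝓘(ℝ, E') F q (Y q))
      (mfderiv 𝓘(ℝ, E) 𝓘(ℝ, E') F q (Z q)) : ℝ)) = fun q => inner ℝ (Y q) (Z q) := by
    funext q
    exact hF.inner_mfderiv_of_mem (hYh q) (hZh q)
  have h3 := leviCivita_metric hX hY hZ
  rw [dInner, ← h2, h1] at h3
  rw [hessian_apply _ _ hY, hessian_apply _ _ hZ, inner_sub_left, inner_sub_left,
    hF.inner_mfderiv _ hv, hF.inner_mfderiv _ hw]
  rw [real_inner_comm _ (mfderiv 𝓘(ℝ, E) 𝓘(ℝ, E') F p (Y p)), real_inner_comm _ (Y p)] at h3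
  linarith

/-- The second fundamental form of a Riemannian submersion vanishes on horizontal vectors. -/
theorem hessian_horizontal {v w : TangentSpace 𝓘(ℝ, E) p}
    (hv : v ∈ horizontal 𝓘(ℝ, E) 𝓘(ℝ, E') F p) (hw : w ∈ horizontal 𝓘(ℝ, E) 𝓘(ℝ, E') F p) :
    hessian hF.smooth p v w = 0 := by
  refine ext_inner_right ℝ fun z => ?_
  obtain ⟨y, rfl⟩ := hF.maximal_rank p z
  have hz := mfderiv_horizontalPart (I := 𝓘(ℝ, E)) (I' := 𝓘(ℝ, E')) F (extend E y) p
  have hu := horizontalPart_mem (I := 𝓘(ℝ, E)) (I' := 𝓘(ℝ, E')) F (extend E y) p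
  rw [extend_apply_self] at hz
  rw [← hz, inner_zero_left]
  set u := horizontalPart 𝓘(ℝ, E) 𝓘(ℝ, E') F (extend E y) p
  have e1 := inner_hessian_horizontal_skew hF v hw hu
  have e2 := inner_hessian_horizontal_skew hF u hv hw
  have e3 := inner_hessian_horizontal_skew hF w hu hv
  rw [hessian_comm _ v u, hessian_comm _ v w] at e1
  rw [hessian_comm _ u w] at e2
  rw [hessian_comm _ v w]
  linarith

/-- The endomorphism of the tangent space representing `⟨(∇F_*)(·,·), z⟩`. -/
def hessianEnd (p : M) (z : TangentSpace 𝓘(ℝ, E') (F p)) :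
    TangentSpace 𝓘(ℝ, E) p →ₗ[ℝ] TangentSpace 𝓘(ℝ, E) p where
  toFun v := LinearMap.adjoint (hessian hF.smooth p v) z
  map_add' v w := by simp
  map_smul' c v := by simp

theorem inner_hessianEnd (z : TangentSpace 𝓘(ℝ, E') (F p)) (v w : TangentSpace 𝓘(ℝ, E) p) :
    inner ℝ (hessianEnd hF p z v) w = inner ℝ z (hessian hF.smooth p v w) :=
  LinearMap.adjoint_inner_left (hessian hF.smooth p v) w z

theorem trace_hessianEnd (z : TangentSpace 𝓘(ℝ, E') (F p)) :
    LinearMap.trace ℝ _ (hessianEnd hF p z) = inner ℝ z (tensionField 𝓘(ℝ, E) 𝓘(ℝ, E') F p) := by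
  rw [LinearMap.trace_eq_sum_inner _ (stdOrthonormalBasis ℝ (TangentSpace 𝓘(ℝ, E) p)),
    tensionField, inner_sum]
  refine Finset.sum_congr rfl fun i _ => ?_
  rw [real_inner_comm, inner_hessianEnd, hessian_extend]

end HessianTensor

section LagrangianTrace

/-! ### The trace of `φ T_V` -/

variable {E : Type*} [NormedAddCommGroup E] [NormedSpace ℝ E] [FiniteDimensional ℝ E]
  {M : Type*} [TopologicalSpace M] [ChartedSpace E M] [IsManifold 𝓘(ℝ, E) ∞ M]
  [RiemannianBundle (fun x : M => TangentSpace 𝓘(ℝ, E) x)]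
  {E' : Type*} [NormedAddCommGroup E'] [NormedSpace ℝ E'] [FiniteDimensional ℝ E']
  {N : Type*} [TopologicalSpace N] [ChartedSpace E' N] [IsManifold 𝓘(ℝ, E') ∞ N]
  [RiemannianBundle (fun x : N => TangentSpace 𝓘(ℝ, E') x)]
  {S : AlmostContactMetricStructure 𝓘(ℝ, E) M} {F : M → N}

set_option linter.unusedSectionVars false

/-- If `φ (ker F_*) = (ker F_*)^⊥`, the characteristic field is vertical. -/
theorem ξ_mem_vertical {p : M}
    (hφ : (vertical 𝓘(ℝ, E) 𝓘(ℝ, E') F p).map (S.φ p).toLinearMap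
      = horizontal 𝓘(ℝ, E) 𝓘(ℝ, E') F p) :
    S.ξ p ∈ vertical 𝓘(ℝ, E) 𝓘(ℝ, E') F p := by
  have h : S.ξ p ∈ (horizontal 𝓘(ℝ, E) 𝓘(ℝ, E') F p)ᗮ := by
    rw [← hφ, Submodule.mem_orthogonal]
    rintro _ ⟨v, -, rfl⟩
    exact (S.η_eq_inner p (S.φ p v)).symm.trans (S.η_φ p v)
  rwa [horizontal, Submodule.orthogonal_orthogonal] at h

theorem φ_mem_horizontal {p : M}
    (hφ : (vertical 𝓘(ℝ, E) 𝓘(ℝ, E') F p).map (S.φ p).toLinearMap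
      = horizontal 𝓘(ℝ, E) 𝓘(ℝ, E') F p) {v : TangentSpace 𝓘(ℝ, E) p}
    (hv : v ∈ vertical 𝓘(ℝ, E) 𝓘(ℝ, E') F p) : S.φ p v ∈ horizontal 𝓘(ℝ, E) 𝓘(ℝ, E') F p :=
  hφ ▸ Submodule.mem_map_of_mem hv

theorem φ_mem_vertical {p : M}
    (hφ : (vertical 𝓘(ℝ, E) 𝓘(ℝ, E') F p).map (S.φ p).toLinearMap
      = horizontal 𝓘(ℝ, E) 𝓘(ℝ, E') F p) {v : TangentSpace 𝓘(ℝ, E) p}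
    (hv : v ∈ horizontal 𝓘(ℝ, E) 𝓘(ℝ, E') F p) : S.φ p v ∈ vertical 𝓘(ℝ, E) 𝓘(ℝ, E') F p := by
  rw [← hφ] at hv
  obtain ⟨u, hu, rfl⟩ := hv
  refine (S.φ_φ p u).symm ▸ Submodule.add_mem _ (Submodule.neg_mem _ hu)
    (Submodule.smul_mem _ _ (ξ_mem_vertical hφ))

theorem starProjection_vertical_φ {p : M}
    (hφ : (vertical 𝓘(ℝ, E) 𝓘(ℝ, E') F p).map (S.φ p).toLinearMap
      = horizontal 𝓘(ℝ, E) 𝓘(ℝ, E') F p) (v : TangentSpace 𝓘(ℝ, E) p) :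
    (vertical 𝓘(ℝ, E) 𝓘(ℝ, E') F p).starProjection (S.φ p v)
      = S.φ p ((horizontal 𝓘(ℝ, E) 𝓘(ℝ, E') F p).starProjection v) := by
  have h1 : (vertical 𝓘(ℝ, E) 𝓘(ℝ, E') F p).starProjection v
      + (horizontal 𝓘(ℝ, E) 𝓘(ℝ, E') F p).starProjection v = v :=
    Submodule.starProjection_add_starProjection_orthogonal _
  exact (Submodule.eq_starProjection_of_mem_orthogonal'
    (z := S.φ p ((vertical 𝓘(ℝ, E) 𝓘(ℝ, E') F p).starProjection v))
    (φ_mem_vertical hφ (Submodule.starProjection_apply_mem _ _))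
    (φ_mem_horizontal hφ (Submodule.starProjection_apply_mem _ _))
    (by rw [← map_add, add_comm, h1]))

theorem starProjection_horizontal_φ {p : M}
    (hφ : (vertical 𝓘(ℝ, E) 𝓘(ℝ, E') F p).map (S.φ p).toLinearMap
      = horizontal 𝓘(ℝ, E) 𝓘(ℝ, E') F p) (v : TangentSpace 𝓘(ℝ, E) p) :
    (horizontal 𝓘(ℝ, E) 𝓘(ℝ, E') F p).starProjection (S.φ p v)
      = S.φ p ((vertical 𝓘(ℝ, E) 𝓘(ℝ, E') F p).starProjection v) := by
  have h1 : (vertical 𝓘(ℝ, E) 𝓘(ℝ, E') F p).starProjection v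
      + (horizontal 𝓘(ℝ, E) 𝓘(ℝ, E') F p).starProjection v = v :=
    Submodule.starProjection_add_starProjection_orthogonal _
  have h2 : (vertical 𝓘(ℝ, E) 𝓘(ℝ, E') F p).starProjection (S.φ p v)
      + (horizontal 𝓘(ℝ, E) 𝓘(ℝ, E') F p).starProjection (S.φ p v) = S.φ p v :=
    Submodule.starProjection_add_starProjection_orthogonal _
  rw [starProjection_vertical_φ hφ] at h2
  refine add_left_cancel (h2.trans ?_)
  rw [← map_add, add_comm, h1]

variable [IsContMDiffRiemannianBundle 𝓘(ℝ, E) ∞ E (fun x : M => TangentSpace 𝓘(ℝ, E) x)]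
  [IsContMDiffRiemannianBundle 𝓘(ℝ, E') ∞ E' (fun x : N => TangentSpace 𝓘(ℝ, E') x)]

theorem tensorialAt_oneillT (hF : IsRiemannianSubmersion 𝓘(ℝ, E) 𝓘(ℝ, E') F) {p : M}
    (v : TangentSpace 𝓘(ℝ, E) p) :
    TensorialAt 𝓘(ℝ, E) E (fun Y => oneillT 𝓘(ℝ, E) 𝓘(ℝ, E') F v Y) p where
  smul {f Y} hf hY := by
    have hc := (leviCivita 𝓘(ℝ, E) M).isCovariantDerivativeOn (s := Set.univ)
    have hV : verticalPart 𝓘(ℝ, E) 𝓘(ℝ, E') F (f • Y) = f • verticalPart 𝓘(ℝ, E) 𝓘(ℝ, E') F Y := by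
      funext q
      simp [verticalPart]
    have hH : horizontalPart 𝓘(ℝ, E) 𝓘(ℝ, E') F (f • Y)
        = f • horizontalPart 𝓘(ℝ, E) 𝓘(ℝ, E') F Y := by
      funext q
      simp [horizontalPart]
    have h1 : (horizontal 𝓘(ℝ, E) 𝓘(ℝ, E') F p).starProjection
        (verticalPart 𝓘(ℝ, E) 𝓘(ℝ, E') F Y p) = 0 :=
      (Submodule.starProjection_apply_eq_zero_iff _).2
        (Submodule.le_orthogonal_orthogonal _ (verticalPart_mem F Y p))
    have h2 : (vertical 𝓘(ℝ, E) 𝓘(ℝ, E') F p).starProjection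
        (horizontalPart 𝓘(ℝ, E) 𝓘(ℝ, E') F Y p) = 0 :=
      (Submodule.starProjection_apply_eq_zero_iff _).2 (horizontalPart_mem F Y p)
    simp only [oneillT, hV, hH, hc.leibniz (hF.mdifferentiableAt_verticalPart hY) hf,
      hc.leibniz (hF.mdifferentiableAt_horizontalPart hY) hf, add_apply, smul_apply,
      ContinuousLinearMap.smulRight_apply, map_add, map_smul, h1, h2, smul_zero, add_zero, smul_add]
  add {Y Y'} hY hY' := by
    have hc := (leviCivita 𝓘(ℝ, E) M).isCovariantDerivativeOn (s := Set.univ)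
    have hV : verticalPart 𝓘(ℝ, E) 𝓘(ℝ, E') F (Y + Y')
        = verticalPart 𝓘(ℝ, E) 𝓘(ℝ, E') F Y + verticalPart 𝓘(ℝ, E) 𝓘(ℝ, E') F Y' := by
      funext q
      simp [verticalPart]
    have hH : horizontalPart 𝓘(ℝ, E) 𝓘(ℝ, E') F (Y + Y')
        = horizontalPart 𝓘(ℝ, E) 𝓘(ℝ, E') F Y + horizontalPart 𝓘(ℝ, E) 𝓘(ℝ, E') F Y' := by
      funext q
      simp [horizontalPart]
    simp only [oneillT, hV, hH, hc.add (hF.mdifferentiableAt_verticalPart hY)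
      (hF.mdifferentiableAt_verticalPart hY'), hc.add (hF.mdifferentiableAt_horizontalPart hY)
      (hF.mdifferentiableAt_horizontalPart hY'), add_apply, map_add]
    abel

/-- O'Neill's tensor `T_v` as an endomorphism of the tangent space. -/
def oneillEnd (hF : IsRiemannianSubmersion 𝓘(ℝ, E) 𝓘(ℝ, E') F) {p : M}
    (v : TangentSpace 𝓘(ℝ, E) p) : TangentSpace 𝓘(ℝ, E) p →L[ℝ] TangentSpace 𝓘(ℝ, E) p :=
  TensorialAt.mkHom (F := E) (fun Y => oneillT 𝓘(ℝ, E) 𝓘(ℝ, E') F v Y) p (tensorialAt_oneillT hF v)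

theorem oneillEnd_apply (hF : IsRiemannianSubmersion 𝓘(ℝ, E) 𝓘(ℝ, E') F) {p : M}
    (v : TangentSpace 𝓘(ℝ, E) p) {Y : Π p : M, TangentSpace 𝓘(ℝ, E) p} (hY : MDiffAt (T% Y) p) :
    oneillEnd hF v (Y p) = oneillT 𝓘(ℝ, E) 𝓘(ℝ, E') F v Y :=
  TensorialAt.mkHom_apply (F := E) (tensorialAt_oneillT hF v) hY

theorem traceφT_eq_trace (hF : IsRiemannianSubmersion 𝓘(ℝ, E) 𝓘(ℝ, E') F) {p : M}
    (v : TangentSpace 𝓘(ℝ, E) p) :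
    traceφT 𝓘(ℝ, E) 𝓘(ℝ, E') S F v
      = LinearMap.trace ℝ _ ((S.φ p).toLinearMap ∘ₗ (oneillEnd hF v).toLinearMap) := by
  rw [LinearMap.trace_eq_sum_inner _ (stdOrthonormalBasis ℝ (TangentSpace 𝓘(ℝ, E) p)), traceφT]
  refine Finset.sum_congr rfl fun i _ => ?_
  rw [real_inner_comm]
  rfl

/-- `T_v` commutes with `φ`. -/
theorem oneillEnd_φ (hS : S.IsCosymplectic) (hF : IsRiemannianSubmersion 𝓘(ℝ, E) 𝓘(ℝ, E') F)
    (hφ : ∀ p : M, (vertical 𝓘(ℝ, E) 𝓘(ℝ, E') F p).map (S.φ p).toLinearMap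
      = horizontal 𝓘(ℝ, E) 𝓘(ℝ, E') F p) {p : M} (v w : TangentSpace 𝓘(ℝ, E) p) :
    oneillEnd hF v (S.φ p w) = S.φ p (oneillEnd hF v w) := by
  obtain ⟨Y, hY, rfl⟩ := exists_field p w
  have hV : verticalPart 𝓘(ℝ, E) 𝓘(ℝ, E') F (S.applyφ Y)
      = S.applyφ (horizontalPart 𝓘(ℝ, E) 𝓘(ℝ, E') F Y) := by
    funext q
    exact starProjection_vertical_φ (hφ q) _
  have hH : horizontalPart 𝓘(ℝ, E) 𝓘(ℝ, E') F (S.applyφ Y)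
      = S.applyφ (verticalPart 𝓘(ℝ, E) 𝓘(ℝ, E') F Y) := by
    funext q
    exact starProjection_horizontal_φ (hφ q) _
  rw [oneillEnd_apply hF v hY]
  refine (oneillEnd_apply hF v (S.mdifferentiableAt_applyφ hY)).trans ?_
  rw [oneillT, oneillT, hV, hH,
    sub_eq_zero.1 (hS.nablaφ_eq_zero (hF.mdifferentiableAt_horizontalPart hY) _),
    sub_eq_zero.1 (hS.nablaφ_eq_zero (hF.mdifferentiableAt_verticalPart hY) _),
    starProjection_horizontal_φ (hφ p), starProjection_vertical_φ (hφ p), map_add, add_comm]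

theorem exists_vertical_field (hF : IsRiemannianSubmersion 𝓘(ℝ, E) 𝓘(ℝ, E') F) {p : M}
    {v : TangentSpace 𝓘(ℝ, E) p} (hv : v ∈ vertical 𝓘(ℝ, E) 𝓘(ℝ, E') F p) :
    ∃ Y : Π p : M, TangentSpace 𝓘(ℝ, E) p, MDiffAt (T% Y) p ∧ Y p = v ∧
      ∀ q, Y q ∈ vertical 𝓘(ℝ, E) 𝓘(ℝ, E') F q :=
  ⟨verticalPart 𝓘(ℝ, E) 𝓘(ℝ, E') F (extend E v),
    hF.mdifferentiableAt_verticalPart (mdifferentiableAt_extend ..), by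
      rw [verticalPart, extend_apply_self]
      exact Submodule.starProjection_eq_self_iff.2 hv, fun q => verticalPart_mem F _ q⟩

/-- For vertical `u`, `w`, `z`, the expression `⟨(∇F_*)(u, w), F_* φ z⟩` is symmetric in `w`
and `z`. -/
theorem inner_hessian_φ_comm (hS : S.IsCosymplectic)
    (hF : IsRiemannianSubmersion 𝓘(ℝ, E) 𝓘(ℝ, E') F)
    (hφ : ∀ p : M, (vertical 𝓘(ℝ, E) 𝓘(ℝ, E') F p).map (S.φ p).toLinearMap
      = horizontal 𝓘(ℝ, E) 𝓘(ℝ, E') F p) {p : M} (u : TangentSpace 𝓘(ℝ, E) p)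
    {w z : TangentSpace 𝓘(ℝ, E) p} (hw : w ∈ vertical 𝓘(ℝ, E) 𝓘(ℝ, E') F p)
    (hz : z ∈ vertical 𝓘(ℝ, E) 𝓘(ℝ, E') F p) :
    inner ℝ (hessian hF.smooth p u w) (mfderiv 𝓘(ℝ, E) 𝓘(ℝ, E') F p (S.φ p z))
      = inner ℝ (hessian hF.smooth p u z) (mfderiv 𝓘(ℝ, E) 𝓘(ℝ, E') F p (S.φ p w)) := by
  obtain ⟨X, hX, rfl⟩ := exists_field p u
  obtain ⟨W, hW, rfl, hWv⟩ := exists_vertical_field hF hw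
  obtain ⟨Z, hZ, rfl, hZv⟩ := exists_vertical_field hF hz
  rw [hessian_of_vertical hF.smooth _ hW hWv, hessian_of_vertical hF.smooth _ hZ hZv,
    inner_neg_left, inner_neg_left, hF.inner_mfderiv _ (φ_mem_horizontal (hφ p) hz),
    hF.inner_mfderiv _ (φ_mem_horizontal (hφ p) hw)]
  have h := leviCivita_metric hX hW (S.mdifferentiableAt_applyφ hZ)
  have h0 : (fun q => (inner ℝ (W q) (S.applyφ Z q) : ℝ)) = fun _ => 0 := by
    funext q
    exact φ_mem_horizontal (hφ q) (hZv q) _ (hWv q)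
  rw [dInner, h0, mvfderiv_const, zero_apply, sub_eq_zero.1 (hS.nablaφ_eq_zero hZ _),
    ← neg_inj.2 (S.inner_φ_left p (W p) _) |>.trans (neg_neg _)] at h
  rw [AlmostContactMetricStructure.applyφ,
    real_inner_comm (leviCivita 𝓘(ℝ, E) M Z p (X p)) (S.φ p (W p))] at h
  linarith

theorem inner_φ_oneillEnd (hS : S.IsCosymplectic)
    (hF : IsRiemannianSubmersion 𝓘(ℝ, E) 𝓘(ℝ, E') F)
    (hφ : ∀ p : M, (vertical 𝓘(ℝ, E) 𝓘(ℝ, E') F p).map (S.φ p).toLinearMap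
      = horizontal 𝓘(ℝ, E) 𝓘(ℝ, E') F p) {p : M} {v u w : TangentSpace 𝓘(ℝ, E) p}
    (hv : v ∈ vertical 𝓘(ℝ, E) 𝓘(ℝ, E') F p) (hu : u ∈ vertical 𝓘(ℝ, E) 𝓘(ℝ, E') F p)
    (hw : w ∈ vertical 𝓘(ℝ, E) 𝓘(ℝ, E') F p) :
    inner ℝ (S.φ p (oneillEnd hF v u)) w
      = inner ℝ (mfderiv 𝓘(ℝ, E) 𝓘(ℝ, E') F p (S.φ p v)) (hessian hF.smooth p u w) := by
  have hT : inner ℝ (oneillEnd hF v u) (S.φ p w)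
      = -inner ℝ (hessian hF.smooth p v u) (mfderiv 𝓘(ℝ, E) 𝓘(ℝ, E') F p (S.φ p w)) := by
    obtain ⟨U, hU, rfl, hUv⟩ := exists_vertical_field hF hu
    have hV : verticalPart 𝓘(ℝ, E) 𝓘(ℝ, E') F U = U := by
      funext q
      exact Submodule.starProjection_eq_self_iff.2 (hUv q)
    have hH : horizontalPart 𝓘(ℝ, E) 𝓘(ℝ, E') F U = 0 := by
      funext q
      exact (Submodule.starProjection_apply_eq_zero_iff _).2
        (Submodule.le_orthogonal_orthogonal _ (hUv q))
    have hw' := φ_mem_horizontal (hφ p) hw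
    rw [oneillEnd_apply hF v hU, oneillT, hV, hH, CovariantDerivative.zero,
      Pi.zero_apply, zero_apply, map_zero, add_zero, Submodule.starProjection_eq_self_iff.2 hv,
      Submodule.inner_starProjection_left_eq_right, Submodule.starProjection_eq_self_iff.2 hw',
      hessian_of_vertical hF.smooth v hU hUv, inner_neg_left, neg_neg, hF.inner_mfderiv _ hw']
  rw [S.inner_φ_left, hT, neg_neg, hessian_comm, inner_hessian_φ_comm hS hF hφ u hv hw,
    real_inner_comm]

/-- `tr (φ T_V) = 2 ⟨τ(F), F_* φ V⟩` for vertical `V`. -/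
theorem traceφT_eq (hS : S.IsCosymplectic)
    (hF : IsRiemannianSubmersion 𝓘(ℝ, E) 𝓘(ℝ, E') F)
    (hφ : ∀ p : M, (vertical 𝓘(ℝ, E) 𝓘(ℝ, E') F p).map (S.φ p).toLinearMap
      = horizontal 𝓘(ℝ, E) 𝓘(ℝ, E') F p) {p : M} {v : TangentSpace 𝓘(ℝ, E) p}
    (hv : v ∈ vertical 𝓘(ℝ, E) 𝓘(ℝ, E') F p) :
    traceφT 𝓘(ℝ, E) 𝓘(ℝ, E') S F v
      = 2 * inner ℝ (mfderiv 𝓘(ℝ, E) 𝓘(ℝ, E') F p (S.φ p v))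
        (tensionField 𝓘(ℝ, E) 𝓘(ℝ, E') F p) := by
  let Pv : Module.End ℝ (TangentSpace 𝓘(ℝ, E) p) :=
    (vertical 𝓘(ℝ, E) 𝓘(ℝ, E') F p).starProjection.toLinearMap
  let Ph : Module.End ℝ (TangentSpace 𝓘(ℝ, E) p) :=
    (horizontal 𝓘(ℝ, E) 𝓘(ℝ, E') F p).starProjection.toLinearMap
  let f : Module.End ℝ (TangentSpace 𝓘(ℝ, E) p) := (S.φ p).toLinearMap
  let T : Module.End ℝ (TangentSpace 𝓘(ℝ, E) p) := (oneillEnd hF v).toLinearMap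
  set A : Module.End ℝ (TangentSpace 𝓘(ℝ, E) p) :=
    hessianEnd hF p (mfderiv 𝓘(ℝ, E) 𝓘(ℝ, E') F p (S.φ p v)) with hA
  have hsum : Pv + Ph = 1 := by
    ext u
    exact Submodule.starProjection_add_starProjection_orthogonal _
  have hv2 : Pv * Pv = Pv := by
    ext u
    exact Submodule.starProjection_eq_self_iff.2 (Submodule.starProjection_apply_mem _ _)
  have hh2 : Ph * Ph = Ph := by
    ext u
    exact Submodule.starProjection_eq_self_iff.2 (Submodule.starProjection_apply_mem _ _)
  have hPhf : Ph * f = f * Pv := by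
    ext u
    exact starProjection_horizontal_φ (hφ p) u
  have hTf : T * f = f * T := by
    ext u
    exact oneillEnd_φ hS hF hφ v u
  have htr (B : Module.End ℝ (TangentSpace 𝓘(ℝ, E) p)) : LinearMap.trace ℝ _ B
      = LinearMap.trace ℝ _ (Pv * B) + LinearMap.trace ℝ _ (Ph * B) := by
    rw [← map_add, ← add_mul, hsum, one_mul]
  have hcompress {P : Module.End ℝ (TangentSpace 𝓘(ℝ, E) p)} (hP : P * P = P)
      (B : Module.End ℝ (TangentSpace 𝓘(ℝ, E) p)) :
      LinearMap.trace ℝ _ (P * B) = LinearMap.trace ℝ _ (P * B * P) := by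
    rw [LinearMap.trace_mul_comm _ (P * B), ← mul_assoc, hP]
  have hL : LinearMap.trace ℝ _ (Ph * (f * T)) = LinearMap.trace ℝ _ (Pv * (f * T)) := by
    rw [← mul_assoc, hPhf, mul_assoc, LinearMap.trace_mul_comm, mul_assoc, hTf]
  have hAh : Ph * A * Ph = 0 := by
    ext u
    refine ext_inner_right ℝ fun w => ?_
    refine (Submodule.inner_starProjection_left_eq_right _ _ _).trans ?_
    refine (inner_hessianEnd hF _ _ _).trans ?_
    refine (congrArg (inner ℝ _) (hessian_horizontal hF (Submodule.starProjection_apply_mem _ _)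
      (Submodule.starProjection_apply_mem _ _))).trans ?_
    rw [inner_zero_right]
    exact (inner_zero_left _).symm
  have hAv : Pv * A * Pv = Pv * (f * T) * Pv := by
    ext u
    refine ext_inner_right ℝ fun w => ?_
    refine (Submodule.inner_starProjection_left_eq_right _ _ _).trans ?_
    refine Eq.trans ?_ (Submodule.inner_starProjection_left_eq_right _ _ _).symm
    exact (inner_hessianEnd hF _ _ _).trans (inner_φ_oneillEnd hS hF hφ hv
      (Submodule.starProjection_apply_mem _ _) (Submodule.starProjection_apply_mem _ _)).symm
  have h1 : traceφT 𝓘(ℝ, E) 𝓘(ℝ, E') S F v = LinearMap.trace ℝ _ (f * T) := traceφT_eq_trace hF v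
  rw [h1, ← trace_hessianEnd hF, ← hA, htr (f * T), hL, htr A, hcompress hh2 A, hAh, map_zero,
    hcompress hv2 A, hAv, ← hcompress hv2]
  ring

theorem isHarmonic_iff (hS : S.IsCosymplectic)
    (hF : IsRiemannianSubmersion 𝓘(ℝ, E) 𝓘(ℝ, E') F)
    (hφ : ∀ p : M, (vertical 𝓘(ℝ, E) 𝓘(ℝ, E') F p).map (S.φ p).toLinearMap
      = horizontal 𝓘(ℝ, E) 𝓘(ℝ, E') F p) :
    IsHarmonic 𝓘(ℝ, E) 𝓘(ℝ, E') F ↔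
      ∀ p : M, ∀ V ∈ vertical 𝓘(ℝ, E) 𝓘(ℝ, E') F p, traceφT 𝓘(ℝ, E) 𝓘(ℝ, E') S F V = 0 := by
  refine ⟨fun h p V hV => ?_, fun h p => ?_⟩
  · rw [traceφT_eq hS hF hφ hV, h p, inner_zero_right, mul_zero]
  · refine ext_inner_left ℝ fun z => ?_
    obtain ⟨y, rfl⟩ := hF.maximal_rank p z
    have hz := mfderiv_horizontalPart (I := 𝓘(ℝ, E)) (I' := 𝓘(ℝ, E')) F (extend E y) p
    have hu := horizontalPart_mem (I := 𝓘(ℝ, E)) (I' := 𝓘(ℝ, E')) F (extend E y) p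
    rw [extend_apply_self] at hz
    rw [← hφ] at hu
    obtain ⟨V, hV, hVu⟩ := hu
    have hVu' : S.φ p V = horizontalPart 𝓘(ℝ, E) 𝓘(ℝ, E') F (extend E y) p := hVu
    have h' := h p V hV
    rw [traceφT_eq hS hF hφ hV, hVu', hz] at h'
    rw [inner_zero_right]
    linarith

end LagrangianTrace

end CosymplecticSubmersion

end

theorem theorem7 {m n : ℕ}
    {M : Type*} [TopologicalSpace M] [T2Space M] [SecondCountableTopology M]
    [ChartedSpace (EuclideanSpace ℝ (Fin (2 * m + 1))) M] [IsManifold (𝓡 (2 * m + 1)) ∞ M]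
    [RiemannianBundle (fun x : M => TangentSpace (𝓡 (2 * m + 1)) x)]
    [IsContMDiffRiemannianBundle (𝓡 (2 * m + 1)) ∞ (EuclideanSpace ℝ (Fin (2 * m + 1)))
      (fun x : M => TangentSpace (𝓡 (2 * m + 1)) x)]
    {N : Type*} [TopologicalSpace N] [T2Space N] [SecondCountableTopology N]
    [ChartedSpace (EuclideanSpace ℝ (Fin n)) N] [IsManifold (𝓡 n) ∞ N]
    [RiemannianBundle (fun x : N => TangentSpace (𝓡 n) x)]
    [IsContMDiffRiemannianBundle (𝓡 n) ∞ (EuclideanSpace ℝ (Fin n))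
      (fun x : N => TangentSpace (𝓡 n) x)]
    (S : CosymplecticSubmersion.AlmostContactMetricStructure (𝓡 (2 * m + 1)) M)
    (hS : S.IsCosymplectic) (F : M → N)
    (hF : CosymplecticSubmersion.IsAntiInvariantSubmersion (𝓡 (2 * m + 1)) (𝓡 n) S F)
    (hφ : ∀ p : M,
      (CosymplecticSubmersion.vertical (𝓡 (2 * m + 1)) (𝓡 n) F p).map (S.φ p).toLinearMap
        = CosymplecticSubmersion.horizontal (𝓡 (2 * m + 1)) (𝓡 n) F p) :
    (∀ p : M, S.ξ p ∈ CosymplecticSubmersion.vertical (𝓡 (2 * m + 1)) (𝓡 n) F p) ∧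
    (CosymplecticSubmersion.IsHarmonic (𝓡 (2 * m + 1)) (𝓡 n) F ↔
      ∀ p : M, ∀ V ∈ CosymplecticSubmersion.vertical (𝓡 (2 * m + 1)) (𝓡 n) F p,
        CosymplecticSubmersion.traceφT (𝓡 (2 * m + 1)) (𝓡 n) S F V = 0) :=
  ⟨fun p => CosymplecticSubmersion.ξ_mem_vertical (hφ p),
    CosymplecticSubmersion.isHarmonic_iff hS hF.toIsRiemannianSubmersion hφ⟩
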